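/- Let $V\in C^2(\mathbb R^2)$ be a function $V(t,x)$ that is $1$-periodic in $t$ and in $x$, and let $W\in C^2(\mathbb R)$ be $1$-periodic and even, with $W\le 0$, $W(x)=0$ if and only if $x\in\mathbb Z$, and $W''(x)<0$ for $x\in\mathbb Z$. Let $I=[0,1)$ with Lebesgue measure, let $L^2(I)=L^2(I,\mathbb R)$, and let $L^2_{\mathbb Z}\subset L^2(I)$ be the subgroup of integer-valued functions. Let $c\in\mathbb R$, and for $t\in\mathbb R$ and $M,N\in L^2(I)$ set $$\mathcal L(t,M,N)=\tfrac12\|N\|_{L^2(I)}^2-\int_I V(t,M(z))\,dz-\tfrac12\int_{I\times I}W(M(z)-M(z'))\,dz\,dz',\qquad \mathcal L_c(t,M,N)=\mathcal L(t,M,N)-c\int_I N(z)\,dz .$$ For an interval $K$, $AC(K,L^2(I))$ is the set of curves $\sigma:K\to L^2(I)$ that are continuous and have a distributional derivative $\dot\sigma\in L^1_{loc}(K,L^2(I))$, i.e. $\int_K\sigma_t\,\phi'(t)\,dt=-\int_K\dot\sigma_t\,\phi(t)\,dt$ for all $C^1$ functions $\phi$ with compact support in the interior of $K$. The integral of $\mathcal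 L_c(t,\sigma_t,\dot\sigma_t)$ along such a curve over a bounded interval is well defined in $(-\infty,+\infty]$. A curve $\sigma\in AC(K,L^2(I))$ is called $c$-minimal for $\mathcal L$ on $K$ if, for all $t_0<t_1$ with $[t_0,t_1]\subset K$ and all $\tilde\sigma\in AC((t_0,t_1),L^2(I))$ that extend continuously to $[t_0,t_1]$ with $\tilde\sigma_{t_0}-\sigma_{t_0}\in L^2_{\mathbb Z}$ and $\tilde\sigma_{t_1}-\sigma_{t_1}\in L^2_{\mathbb Z}$, $$\int_{t_0}^{t_1}\mathcal L_c(t,\sigma_t,\dot\sigma_t)\,dt\le\int_{t_0}^{t_1}\mathcal L_c(t,\tilde\sigma_t,\dot{\tilde\sigma}_t)\,dt .$$ Let $Mon$ be the set of $M\in L^2(I)$ that have a nondecreasing representative $M:[0,1)\to\mathbb R$ with $M(1-)\le M(0)+1$. **Proposition 2.2.** Let $U:L^2(I)\to\mathbb R$ be continuous, with $U(M+Z)=U(M)$ for all $M\in L^2(I)$, $Z\in L^2_{\mathbb Z}$, and $U(M\circ G)=U(M)$ for all $M\in L^2(I)$ and all measure-preserving measurable bijections $G$ of $I$ with measurable inverse.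 Let $M\in Mon$ and $$\hat U(M)=\inf\Big\{\int_0^1\mathcal L_c(t,\sigma_t,\dot\sigma_t)\,dt+U(\sigma_1)\;:\;\sigma\in AC([0,1],L^2(I)),\ \sigma_0=M\Big\}.$$ Then $\hat U(M)$ is finite, and there is $\sigma\in AC([0,1],L^2(I))$ with $\sigma_0=M$ that attains the infimum, that is $c$-minimal for $\mathcal L$ on $[0,1]$, and that satisfies $\sigma_t\in Mon$ for all $t\in[0,1]$. -/

import Mathlib

noncomputable section

namespace Vlasov

open MeasureTheory

/-- The parameter space `I = [0,1)`, with Lebesgue measure `volume`. -/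
abbrev ParamI : Type := Set.Ico (0 : ℝ) 1

instance : MeasureSpace ParamI := Measure.Subtype.measureSpace

/-- The left endpoint `0` of `I`. -/
def ParamI.left : ParamI := ⟨0, by norm_num⟩

/-- The Hilbert space `L²(I) = L²(I, ℝ)`. -/
abbrev L2I : Type := Lp ℝ 2 (volume : Measure ParamI)

/-- The standing assumptions on the external potential `V(t,x)` and the interaction `W(x)`.
Functions on `S¹ × S¹` and on `S¹` are functions on `ℝ × ℝ` and on `ℝ`, with period `1` in each
variable. -/
structure IsPotentialPair (V : ℝ → ℝ → ℝ) (W : ℝ → ℝ) : Prop where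
  contDiff_V : ContDiff ℝ 2 (Function.uncurry V)
  periodic_time_V : ∀ t x, V (t + 1) x = V t x
  periodic_space_V : ∀ t x, V t (x + 1) = V t x
  contDiff_W : ContDiff ℝ 2 W
  periodic_W : ∀ x, W (x + 1) = W x
  even_W : ∀ x, W (-x) = W x
  nonpos_W : ∀ x, W x ≤ 0
  zero_W : ∀ x, W x = 0 ↔ ∃ k : ℤ, x = k
  second_deriv_W : ∀ k : ℤ, deriv (deriv W) (k : ℝ) < 0

/-- The subgroup `L²_ℤ = L²(I, ℤ)` of `L²(I)`, as a predicate. -/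
def IsIntegerValued (Z : L2I) : Prop := ∀ᵐ z, ∃ k : ℤ, Z z = k

/-- `U` is a continuous function on `L²(I)` that is invariant under translations by `L²_ℤ` and
under composition with the measure-preserving bijections of `I` that are measurable
with measurable inverse. -/
structure IsInvariantContinuous (U : L2I → ℝ) : Prop where
  continuous : Continuous U
  translation : ∀ M Z : L2I, IsIntegerValued Z → U (M + Z) = U M
  rearrangement : ∀ (M : L2I) (G : ParamI ≃ᵐ ParamI) (hG : MeasurePreserving G volume volume),
    U (Lp.compMeasurePreserving G hG M) = U M

/-- `M ∈ Mon`: the class `M` has a nondecreasing representative `f : [0,1) → ℝ` with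
`f(1-) ≤ f(0) + 1`. As `f` is nondecreasing, `f(1-)` is the supremum of its values. -/
def IsMon (M : L2I) : Prop :=
  ∃ f : ParamI → ℝ, Monotone f ∧ (∀ x, f x ≤ f ParamI.left + 1) ∧ M =ᵐ[volume] f

/-- The potential energy `∫_I V(t, M z) dz` due to the external potential. -/
def externalEnergy (V : ℝ → ℝ → ℝ) (t : ℝ) (M : L2I) : ℝ := ∫ z, V t (M z)

/-- The interaction energy `½ ∫_{I×I} W(M z - M z') dz dz'`. -/
def interactionEnergy (W : ℝ → ℝ) (M : L2I) : ℝ :=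
  (1 / 2) * ∫ p : ParamI × ParamI, W (M p.1 - M p.2)

/-- The Lagrangian `𝓛(t,M,N)`. -/
def lagrangian (V : ℝ → ℝ → ℝ) (W : ℝ → ℝ) (t : ℝ) (M N : L2I) : ℝ :=
  (1 / 2) * ‖N‖ ^ 2 - externalEnergy V t M - interactionEnergy W M

/-- The Lagrangian `𝓛_c(t,M,N) = 𝓛(t,M,N) - ⟨c,N⟩`, the number `c` being identified with the
constant function on `I`. -/
def lagrangianC (V : ℝ → ℝ → ℝ) (W : ℝ → ℝ) (c t : ℝ) (M N : L2I) : ℝ :=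
  lagrangian V W t M N - ∫ z, c * N z

/-- `σ` is an absolutely continuous curve in `L²(I)` on the interval `K` with derivative `v`, in
the sense of distributions: `v ∈ L¹_loc(K, L²(I))` and `∫_K φ' σ dt = - ∫_K φ v dt` for all `C¹`
functions `φ` with compact support in the interior of `K`. The curve is the continuous
representative of its class, so that the values `σ t` make sense for all `t ∈ K`. -/
structure HasWeakDerivOn (K : Set ℝ) (σ v : ℝ → L2I) : Prop where
  continuousOn : ContinuousOn σ K
  locallyIntegrableOn : LocallyIntegrableOn v K
  integral_eq : ∀ φ : ℝ → ℝ, ContDiff ℝ 1 φ → HasCompactSupport φ → tsupport φ ⊆ interior K →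
    ∫ t in K, deriv φ t • σ t = -∫ t in K, φ t • v t

/-- `σ ∈ AC(K, L²(I))`. -/
def IsAC (K : Set ℝ) (σ : ℝ → L2I) : Prop := ∃ v, HasWeakDerivOn K σ v

/-- The integral of a real function as an extended real number, namely the integral of the
positive part minus that of the negative part. -/
def extIntegral (a b : ℝ) (f : ℝ → ℝ) : EReal :=
  ((∫⁻ t in Set.Ioo a b, ENNReal.ofReal (f t) : ENNReal) : EReal) -
    ((∫⁻ t in Set.Ioo a b, ENNReal.ofReal (-f t) : ENNReal) : EReal)

/-- The action `∫_a^b 𝓛_c(t, σ_t, v_t) dt ∈ (-∞, +∞]` of the curve `σ` with derivative `v`. -/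
def action (V : ℝ → ℝ → ℝ) (W : ℝ → ℝ) (c a b : ℝ) (σ v : ℝ → L2I) : EReal :=
  extIntegral a b fun t => lagrangianC V W c t (σ t) (v t)

/-- `σ ∈ AC(K, L²(I))` is `c`-minimal for `𝓛` on `K`: on each `[t₀,t₁] ⊆ K` its action is at most
that of each absolutely continuous curve on `(t₀,t₁)` whose boundary values at `t₀` and `t₁` agree
with those of `σ` up to elements of `L²_ℤ`. (Derivatives are unique up to null sets.) -/
def IsCMinimal (V : ℝ → ℝ → ℝ) (W : ℝ → ℝ) (c : ℝ) (K : Set ℝ) (σ : ℝ → L2I) : Prop :=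
  IsAC K σ ∧
  ∀ t₀ t₁ : ℝ, t₀ < t₁ → Set.Icc t₀ t₁ ⊆ K →
    ∀ v, HasWeakDerivOn (Set.Icc t₀ t₁) σ v →
    ∀ σ' v', HasWeakDerivOn (Set.Ioo t₀ t₁) σ' v' → ContinuousOn σ' (Set.Icc t₀ t₁) →
      IsIntegerValued (σ' t₀ - σ t₀) → IsIntegerValued (σ' t₁ - σ t₁) →
      action V W c t₀ t₁ σ v ≤ action V W c t₀ t₁ σ' v'

/-- The Lax–Oleinik infimum `Û(M)`: the infimum of `∫_0^1 𝓛_c(t, σ_t, σ̇_t) dt + U(σ_1)` over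
`σ ∈ AC([0,1], L²(I))` with `σ_0 = M`. -/
def laxOleinik (V : ℝ → ℝ → ℝ) (W : ℝ → ℝ) (c : ℝ) (U : L2I → ℝ) (M : L2I) : EReal :=
  sInf {A : EReal | ∃ σ v : ℝ → L2I, HasWeakDerivOn (Set.Icc 0 1) σ v ∧ σ 0 = M ∧
    A = action V W c 0 1 σ v + (U (σ 1) : EReal)}

end Vlasov

end

noncomputable section

namespace Vlasov

open MeasureTheory Filter Topology

/-! The potential energy and `U` do not see measure-preserving bijections of `I` or integer-valued
translations, and the term with `c` integrates to a difference of means. So a curve may be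
rearranged at each time, provided that its mean is kept and its kinetic energy does not grow.
Rearranging into `Mon` does this and brings compactness.

On step functions with `n` equal steps the symmetries act on vectors by permutations and integer
shifts; only shifts of sum zero are used, because these keep the mean. Each orbit contains exactly
one vector of `IsMonVec` type: a point of the orbit closest to a strictly ordered vector must itself
be ordered, and `OrbitRel.sum_floor` is an invariant that gives uniqueness. Hence, between ordered
vectors, no other choice in the orbits is closer, and sorting is a contraction
(`IsMonVec.sum_sq_le`). Projecting a curve to step functions and sorting it at each time yields a
curve in `Mon` with increments no larger (`exists_isMon_curve`).

Norm-bounded subsets of `Mon` are compact in `L²(I)` (`isCompact_isMon`). This bounds `U`, so that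
costs are bounded below and minimizing sequences have bounded kinetic energy. The sorted curves are
then uniformly Hölder of exponent 1/2, and Arzelà–Ascoli gives a limit
(`exists_subseq_limit_curve`). Kinetic energy is compared through increments on dyadic grids, which
pass to pointwise limits; a velocity is constructed only for the limit, in
`exists_velocity_of_gridEnergy_le`. The limit is a minimizer in `Mon`.

The minimizer is `c`-minimal because a better piece on a subinterval could be spliced in after
integer-valued translations, with no change of `U` at the end (`isCMinimal_of_cost_le`). -/

/-! ### Sorting vectors modulo permutations and integer shifts. -/

/-- A vector that is nondecreasing and whose last entry exceeds the first by at most `1`: the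
vector of values of a step function in `Mon`. -/
structure IsMonVec {n : ℕ} (y : Fin n → ℝ) : Prop where
  monotone : Monotone y
  le_add_one : ∀ i j, y j ≤ y i + 1

/-- The vectors `x` and `y` agree up to a permutation of the entries and the addition of integers
with sum zero. -/
def OrbitRel {n : ℕ} (x y : Fin n → ℝ) : Prop :=
  ∃ (p : Equiv.Perm (Fin n)) (z : Fin n → ℤ), ∑ i, z i = 0 ∧ ∀ i, y i = x (p i) + z i

namespace OrbitRel

variable {n : ℕ} {x y w : Fin n → ℝ}

theorem refl (x : Fin n → ℝ) : OrbitRel x x := ⟨1, 0, by simp, by simp⟩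

theorem symm (h : OrbitRel x y) : OrbitRel y x := by
  obtain ⟨p, z, hz, h⟩ := h
  refine ⟨p.symm, fun i => -z (p.symm i), ?_, fun i => ?_⟩
  · rw [Finset.sum_neg_distrib, Equiv.sum_comp p.symm z, hz, neg_zero]
  · rw [h]; simp

theorem trans (h : OrbitRel x y) (h' : OrbitRel y w) : OrbitRel x w := by
  obtain ⟨p, z, hz, h⟩ := h
  obtain ⟨q, u, hu, h'⟩ := h'
  refine ⟨q.trans p, fun i => z (q i) + u i, ?_, fun i => ?_⟩
  · rw [Finset.sum_add_distrib, Equiv.sum_comp q z, hz, hu, add_zero]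
  · rw [h', h]; simp [add_assoc]

theorem sum_eq (h : OrbitRel x y) : ∑ i, y i = ∑ i, x i := by
  obtain ⟨p, z, hz, h⟩ := h
  simp_rw [h, Finset.sum_add_distrib, Equiv.sum_comp p x, ← Int.cast_sum, hz]
  simp

/-- As a function of `t` this is a counting function of the integer translates of the entries. It
separates ordered vectors, which makes it the invariant behind uniqueness. The integer shifts leave
the floors and cancel because their sum is zero. -/
theorem sum_floor (h : OrbitRel x y) (t : ℝ) : ∑ i, ⌊t - y i⌋ = ∑ i, ⌊t - x i⌋ := by
  obtain ⟨p, z, hz, h⟩ := h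
  have : ∀ i, ⌊t - y i⌋ = ⌊t - x (p i)⌋ - z i := fun i => by
    rw [h, ← sub_sub, Int.floor_sub_intCast]
  simp_rw [this, Finset.sum_sub_distrib, hz, sub_zero]
  exact Equiv.sum_comp p fun i => ⌊t - x i⌋

/-- Moving the same permutation and shift to another vector. -/
theorem exists_dist_eq (h : OrbitRel x y) (x' : Fin n → ℝ) :
    ∃ y', OrbitRel x' y' ∧ ∑ i, (y i - y' i) ^ 2 = ∑ i, (x i - x' i) ^ 2 := by
  obtain ⟨p, z, hz, h⟩ := h
  refine ⟨fun i => x' (p i) + z i, ⟨p, z, hz, fun i => rfl⟩, ?_⟩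
  rw [← Equiv.sum_comp p fun i => (x i - x' i) ^ 2]
  exact Finset.sum_congr rfl fun i _ => by rw [h]; ring

/-- The elementary move of the exchange argument: two entries trade places while an integer passes
from one to the other, so the sum is kept. -/
theorem update_swap (w : Fin n → ℝ) {i j : Fin n} (hij : i ≠ j) (k : ℤ) :
    OrbitRel w (Function.update (Function.update w i (w j - k)) j (w i + k)) := by
  refine ⟨Equiv.swap i j, Function.update (Function.update 0 i (-k)) j k, ?_, fun l => ?_⟩
  · rw [Finset.sum_update_of_mem (Finset.mem_univ j), Finset.sum_update_of_mem (by simp [hij])]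
    simp
  · by_cases hl : l = j
    · subst hl; simp
    by_cases hl' : l = i
    · subst hl'; simp [hij, sub_eq_add_neg]
    · simp [hl, hl', Equiv.swap_apply_of_ne_of_ne]

end OrbitRel

theorem sum_update_update {n : ℕ} (y w : Fin n → ℝ) {i j : Fin n} (hij : i ≠ j) (a b : ℝ) :
    ∑ l, (y l - Function.update (Function.update w i a) j b l) ^ 2 =
      ∑ l, (y l - w l) ^ 2 + ((y i - a) ^ 2 - (y i - w i) ^ 2) +
        ((y j - b) ^ 2 - (y j - w j) ^ 2) := by
  have key : ∀ f : Fin n → ℝ, ∑ l, f l = f i + f j + ∑ l ∈ (Finset.univ.erase i).erase j, f l := by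
    intro f
    rw [← Finset.add_sum_erase _ _ (Finset.mem_univ i),
      ← Finset.add_sum_erase (Finset.univ.erase i) f (a := j) (by simp [hij.symm]), add_assoc]
  rw [key, key fun l => (y l - w l) ^ 2]
  have : ∑ l ∈ (Finset.univ.erase i).erase j,
      (y l - Function.update (Function.update w i a) j b l) ^ 2 =
      ∑ l ∈ (Finset.univ.erase i).erase j, (y l - w l) ^ 2 := by
    refine Finset.sum_congr rfl fun l hl => ?_
    simp only [Finset.mem_erase, Finset.mem_univ, and_true] at hl
    simp [hl.1, hl.2]
  rw [this]
  simp [hij]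
  ring

/-- Only finitely many orbit points lie as close to `y` as `x` does, since their integer shifts are
bounded. -/
theorem exists_orbit_minimizer {n : ℕ} (y x : Fin n → ℝ) :
    ∃ w, OrbitRel x w ∧ ∀ w', OrbitRel x w' → ∑ i, (y i - w i) ^ 2 ≤ ∑ i, (y i - w' i) ^ 2 := by
  classical
  set C : ℝ := ∑ i, (y i - x i) ^ 2 with hC
  have hfin : {w : Fin n → ℝ | OrbitRel x w ∧ ∑ i, (y i - w i) ^ 2 ≤ C}.Finite := by
    -- The shift is `y i - (y i - w i) - x (p i)`, and the middle term is at most `C + 1` in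
    -- absolute value because its square is at most `C`.
    let N : ℤ := ⌈C + 1 + ∑ i, |y i| + ∑ i, |x i|⌉
    refine ((Set.finite_univ (α := Equiv.Perm (Fin n))).prod
      (Set.finite_Icc (fun _ : Fin n => -N) (fun _ => N))).image
      (fun q : Equiv.Perm (Fin n) × (Fin n → ℤ) => fun i => x (q.1 i) + (q.2 i : ℝ)) |>.subset ?_
    rintro w ⟨⟨p, z, -, hw⟩, hle⟩
    refine ⟨(p, z), ⟨Set.mem_univ _, ?_⟩, funext fun i => (hw i).symm⟩
    have hb : ∀ i, |(z i : ℝ)| ≤ N := fun i => by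
      refine le_trans ?_ (Int.le_ceil _)
      have h1 : (y i - w i) ^ 2 ≤ C :=
        (Finset.single_le_sum (f := fun i => (y i - w i) ^ 2) (fun _ _ => sq_nonneg _)
          (Finset.mem_univ i)).trans hle
      have h2 : |y i| ≤ ∑ i, |y i| :=
        Finset.single_le_sum (f := fun i => |y i|) (fun _ _ => abs_nonneg _) (Finset.mem_univ i)
      have h3 : |x (p i)| ≤ ∑ i, |x i| :=
        Finset.single_le_sum (f := fun i => |x i|) (fun _ _ => abs_nonneg _) (Finset.mem_univ (p i))
      have h4 : |y i - w i| ≤ C + 1 := by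
        rw [← sq_abs] at h1
        nlinarith [sq_nonneg (|y i - w i| - 1), abs_nonneg (y i - w i)]
      have h5 : (z i : ℝ) = y i - (y i - w i) - x (p i) := by rw [hw]; ring
      rw [h5]
      have := abs_sub (y i - (y i - w i)) (x (p i))
      have := abs_sub (y i) (y i - w i)
      linarith
    constructor
    · intro i
      have := (abs_le.1 (hb i)).1
      show -N ≤ z i
      exact_mod_cast this
    · intro i
      have := (abs_le.1 (hb i)).2
      show z i ≤ N
      exact_mod_cast this
  obtain ⟨w, hw, hmin⟩ := Set.exists_min_image _ (fun w : Fin n → ℝ => ∑ i, (y i - w i) ^ 2) hfin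
    ⟨x, OrbitRel.refl x, le_rfl⟩
  refine ⟨w, hw.1, fun w' hw' => ?_⟩
  by_cases h : ∑ i, (y i - w' i) ^ 2 ≤ C
  · exact hmin w' ⟨hw', h⟩
  · exact hw.2.trans (not_le.1 h).le

/-- An exchange argument. Swapping the values `w i` and `w j + k` changes the squared distance to
`y` by `2 (y i - (y j + k)) (w i - (w j + k))`, which would be negative if the two factors had
opposite signs. The choice `k = 0` gives monotonicity and `k = 1` gives the bound on the spread. -/
theorem exists_isMonVec_minimizer {n : ℕ} (y x : Fin n → ℝ) (hy : StrictMono y)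
    (hy1 : ∀ i j, y j < y i + 1) :
    ∃ w, OrbitRel x w ∧ IsMonVec w ∧
      ∀ w', OrbitRel x w' → ∑ i, (y i - w i) ^ 2 ≤ ∑ i, (y i - w' i) ^ 2 := by
  obtain ⟨w, hw, hmin⟩ := exists_orbit_minimizer y x
  have key : ∀ i j, i < j → ∀ k : ℤ, y i < y j + k → w i ≤ w j + k := by
    intro i j hij k hk
    have h := hmin _ (hw.trans (OrbitRel.update_swap w hij.ne (-k)))
    rw [sum_update_update y w hij.ne] at h
    push_cast at h
    by_contra hlt
    nlinarith [mul_pos (sub_pos.2 hk) (sub_pos.2 (not_le.1 hlt))]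
  have key' : ∀ i j, i < j → ∀ k : ℤ, y j < y i + k → w j ≤ w i + k := by
    intro i j hij k hk
    have h := hmin _ (hw.trans (OrbitRel.update_swap w hij.ne k))
    rw [sum_update_update y w hij.ne] at h
    by_contra hlt
    nlinarith [mul_pos (sub_pos.2 hk) (sub_pos.2 (not_le.1 hlt))]
  have hmono : Monotone w := by
    intro i j hij
    rcases hij.eq_or_lt with rfl | hij
    · rfl
    · have := key i j hij 0 (by simpa using hy hij)
      simpa using this
  refine ⟨w, hw, ⟨hmono, fun i j => ?_⟩, hmin⟩
  rcases le_or_gt j i with hij | hij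
  · linarith [hmono hij]
  · have := key' i j hij 1 (by simpa using hy1 i j)
    simpa using this

/-- If `w i < y i`, the floor sums at `t = w i` differ: for `j ≤ i` the floors are at least 0 for
`w` and at most 0 for `y`, for `j > i` they are at least -1 and at most -1, and at `j = i` the
inequality is strict. -/
theorem IsMonVec.le_of_orbitRel {n : ℕ} {y w : Fin n → ℝ} (hy : IsMonVec y) (hw : IsMonVec w)
    (h : OrbitRel y w) (i : Fin n) : y i ≤ w i := by
  by_contra! hlt
  have h1 := h.sum_floor (w i)
  have hlt' : ∑ j, ⌊w i - y j⌋ < ∑ j, ⌊w i - w j⌋ := by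
    refine Finset.sum_lt_sum (fun j _ => ?_) ⟨i, Finset.mem_univ i, ?_⟩
    · rcases le_or_gt j i with hji | hji
      · have a1 : (0 : ℤ) ≤ ⌊w i - w j⌋ := Int.le_floor.2 (by simpa using hw.monotone hji)
        have a2 : ⌊w i - y j⌋ < 1 := Int.floor_lt.2 (by
          push_cast; linarith [hy.le_add_one j i])
        omega
      · have a1 : (-1 : ℤ) ≤ ⌊w i - w j⌋ := Int.le_floor.2 (by
          push_cast; linarith [hw.le_add_one i j])
        have a2 : ⌊w i - y j⌋ < 0 := Int.floor_lt.2 (by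
          push_cast; linarith [hy.monotone hji.le])
        omega
    · have a2 : ⌊w i - y i⌋ < 0 := Int.floor_lt.2 (by push_cast; linarith)
      simpa using a2
  omega

theorem IsMonVec.eq_of_orbitRel {n : ℕ} {y w : Fin n → ℝ} (hy : IsMonVec y) (hw : IsMonVec w)
    (h : OrbitRel y w) : y = w :=
  funext fun i => le_antisymm (hy.le_of_orbitRel hw h i) (hw.le_of_orbitRel hy h.symm i)

theorem grid_strictMono (n : ℕ) : StrictMono fun i : Fin n => (i : ℝ) / n := fun i j hij => by
  have : (0 : ℝ) < n := by exact_mod_cast (Nat.zero_le _).trans_lt i.2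
  have h : (i : ℝ) < j := by exact_mod_cast hij
  show (i : ℝ) / n < j / n
  gcongr

theorem grid_lt_add_one (n : ℕ) (i j : Fin n) : (j : ℝ) / n < (i : ℝ) / n + 1 := by
  have hn : (0 : ℝ) < n := by exact_mod_cast (Nat.zero_le _).trans_lt i.2
  have h : (j : ℝ) < n := by exact_mod_cast j.2
  have : (j : ℝ) / n < 1 := (div_lt_one hn).2 h
  have : 0 ≤ (i : ℝ) / n := by positivity
  linarith

theorem exists_isMonVec_orbitRel {n : ℕ} (x : Fin n → ℝ) : ∃ w, OrbitRel x w ∧ IsMonVec w := by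
  obtain ⟨w, hw, hm, -⟩ := exists_isMonVec_minimizer _ x (grid_strictMono n) (grid_lt_add_one n)
  exact ⟨w, hw, hm⟩

/-- For strictly ordered `y` the closest orbit point is ordered, hence equals `y'` by uniqueness.
The general case follows by moving `y` slightly towards the strictly ordered vector with entries
`i/n`. -/
theorem IsMonVec.sum_sq_le_of_orbitRel {n : ℕ} {y y' w : Fin n → ℝ} (hy : IsMonVec y)
    (hy' : IsMonVec y') (h : OrbitRel y' w) :
    ∑ i, (y i - y' i) ^ 2 ≤ ∑ i, (y i - w i) ^ 2 := by
  let a : ℝ → Fin n → ℝ := fun s i => (1 - s) * y i + s * ((i : ℝ) / n)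
  have key : ∀ s ∈ Set.Ioo (0 : ℝ) 1, ∑ i, (a s i - y' i) ^ 2 ≤ ∑ i, (a s i - w i) ^ 2 := by
    rintro s ⟨hs0, hs1⟩
    obtain ⟨u, hu, hum, hmin⟩ := exists_isMonVec_minimizer (a s) y' (fun i j hij => by
        have h1 := hy.monotone hij.le
        have h2 := grid_strictMono n hij
        simp only [a]
        simp only at h2
        nlinarith [mul_nonneg (sub_nonneg.2 hs1.le) (sub_nonneg.2 h1),
          mul_pos hs0 (sub_pos.2 h2)])
      (fun i j => by
        have h1 := hy.le_add_one i j
        have h2 := grid_lt_add_one n i j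
        simp only [a]
        nlinarith [mul_nonneg (sub_nonneg.2 hs1.le) (sub_nonneg.2 h1),
          mul_pos hs0 (sub_pos.2 h2)])
    rw [hy'.eq_of_orbitRel hum hu]
    exact hmin w h
  have hcont : ∀ b : Fin n → ℝ, Filter.Tendsto (fun s => ∑ i, (a s i - b i) ^ 2)
      (nhdsWithin 0 (Set.Ioo 0 1)) (nhds (∑ i, (y i - b i) ^ 2)) := by
    intro b
    have : Continuous fun s => ∑ i, (a s i - b i) ^ 2 := by
      simp only [a]; fun_prop
    have := (this.tendsto 0).mono_left (nhdsWithin_le_nhds (s := Set.Ioo (0 : ℝ) 1))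
    simpa [a] using this
  have : (nhdsWithin (0 : ℝ) (Set.Ioo 0 1)).NeBot := by
    rw [← mem_closure_iff_nhdsWithin_neBot, closure_Ioo (by norm_num)]; simp
  exact le_of_tendsto_of_tendsto (hcont y') (hcont w)
    (Filter.eventually_of_mem self_mem_nhdsWithin key)

/-- Sorting modulo `1` is a contraction in `ℓ²`. -/
theorem IsMonVec.sum_sq_le {n : ℕ} {x x' y y' : Fin n → ℝ} (hy : IsMonVec y) (hy' : IsMonVec y')
    (h : OrbitRel x y) (h' : OrbitRel x' y') :
    ∑ i, (y i - y' i) ^ 2 ≤ ∑ i, (x i - x' i) ^ 2 := by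
  obtain ⟨w, hw, he⟩ := h.exists_dist_eq x'
  rw [← he]
  exact hy.sum_sq_le_of_orbitRel hy' (h'.symm.trans hw)

/-! ### Norm, mean and Cauchy–Schwarz on the parameter space. -/

instance : IsProbabilityMeasure (volume : Measure ParamI) := ⟨by
  show Measure.comap Subtype.val volume Set.univ = 1
  rw [comap_subtype_coe_apply measurableSet_Ico, Set.image_univ, Subtype.range_coe]
  simp⟩

instance : LocallyCompactSpace ParamI :=
  IsLocallyClosed.locallyCompactSpace (isClosed_Ici.isLocallyClosed.inter isOpen_Iio.isLocallyClosed)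

theorem norm_sq_eq_integral (M : L2I) : ‖M‖ ^ 2 = ∫ z, M z ^ 2 := by
  rw [← real_inner_self_eq_norm_sq, L2.inner_def]
  simp [sq]

theorem integrable_coe (M : L2I) : Integrable (M : ParamI → ℝ) :=
  (Lp.memLp M).integrable (by norm_num)

theorem norm_le_of_ae_bound {M : L2I} {C : ℝ} (hC : 0 ≤ C) (h : ∀ᵐ z, ‖M z‖ ≤ C) : ‖M‖ ≤ C := by
  simpa [measureUnivNNReal] using Lp.norm_le_of_ae_bound hC h

/-- The mean value of a function. -/
def mean : L2I →L[ℝ] ℝ :=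
  innerSL ℝ (indicatorConstLp 2 (μ := (volume : Measure ParamI)) MeasurableSet.univ
    (measure_ne_top _ _) (1 : ℝ))

theorem mean_apply (M : L2I) : mean M = ∫ z, M z := by
  rw [mean, innerSL_apply_apply, L2.inner_indicatorConstLp_one, setIntegral_univ]

/-- Cauchy–Schwarz against the constant 1, read off from the nonnegative integral of `(L * g - m) ^
2`. -/
theorem sq_integral_le {α : Type*} [MeasurableSpace α] {μ : Measure α} [IsFiniteMeasure μ]
    {g : α → ℝ} (hg : MemLp g 2 μ) : (∫ x, g x ∂μ) ^ 2 ≤ μ.real Set.univ * ∫ x, g x ^ 2 ∂μ := by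
  set L := μ.real Set.univ with hL
  set m := ∫ x, g x ∂μ with hm
  rcases (measureReal_nonneg : 0 ≤ μ.real Set.univ).eq_or_lt with h0 | h0
  · have : μ = 0 := by simpa using (measureReal_eq_zero_iff (μ := μ)).1 h0.symm
    simp [hm, this]
  have h1 : Integrable g μ := hg.integrable (by norm_num)
  have h2 : Integrable (fun x => g x ^ 2) μ := hg.integrable_sq
  have h3 : 0 ≤ ∫ x, (L * g x - m) ^ 2 ∂μ := integral_nonneg fun _ => sq_nonneg _
  have h4 : ∀ x, (L * g x - m) ^ 2 = L ^ 2 * g x ^ 2 - 2 * L * m * g x + m ^ 2 := fun x => by ring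
  simp_rw [h4] at h3
  rw [integral_add (f := fun x => L ^ 2 * g x ^ 2 - 2 * L * m * g x)
    ((h2.const_mul _).sub (h1.const_mul _)) (integrable_const _), integral_sub (h2.const_mul _)
    (h1.const_mul _), integral_const_mul, integral_const_mul, integral_const, smul_eq_mul, ← hm,
    ← hL] at h3
  have h5 : 0 ≤ L * (L * ∫ x, g x ^ 2 ∂μ) - L * m ^ 2 := by linarith
  rw [← mul_sub] at h5
  linarith [nonneg_of_mul_nonneg_right h5 h0]

theorem abs_integral_le_norm (M : L2I) : ∫ z, |M z| ≤ ‖M‖ := by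
  have h := sq_integral_le (Lp.memLp M).norm
  simp only [Real.norm_eq_abs, sq_abs, ← norm_sq_eq_integral, probReal_univ, one_mul] at h
  exact (abs_le_of_sq_le_sq' h (norm_nonneg _)).2

theorem abs_mean_le (M : L2I) : |mean M| ≤ ‖M‖ := by
  rw [mean_apply]
  exact (abs_integral_le_integral_abs).trans (abs_integral_le_norm M)

/-! ### Step functions on equal cells, permutations of cells, projections. -/

section Cells

variable (n : ℕ)

/-- The relative position of `z` in the interval `[i/n, (i+1)/n)` that contains it. -/
def cellFract (z : ParamI) : ParamI :=
  ⟨Int.fract (n * (z : ℝ)), Int.fract_nonneg _, Int.fract_lt_one _⟩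

theorem measurable_cellFract : Measurable (cellFract n) :=
  (measurable_fract.comp (measurable_subtype_coe.const_mul _)).subtype_mk

variable [NeZero n]

theorem cast_pos_of_neZero : (0 : ℝ) < n := by exact_mod_cast Nat.pos_of_ne_zero (NeZero.ne n)

/-- The index `i` of the interval `[i/n, (i+1)/n)` that contains `z`. -/
def cellIndex (z : ParamI) : Fin n :=
  ⟨⌊n * (z : ℝ)⌋₊, by
    have := cast_pos_of_neZero n
    rw [Nat.floor_lt (mul_nonneg this.le z.2.1)]
    nlinarith [z.2.2]⟩

/-- The affine bijection from `[0,1)` onto `[i/n, (i+1)/n)`. -/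
def cellPoint (i : Fin n) (w : ParamI) : ParamI :=
  ⟨((i : ℕ) + (w : ℝ)) / n, by
    have := cast_pos_of_neZero n
    have := w.2.1
    positivity, by
    rw [div_lt_one (cast_pos_of_neZero n)]
    have h : ((i : ℕ) : ℝ) + 1 ≤ n := by exact_mod_cast i.2
    linarith [w.2.2]⟩

theorem mul_coe_cellPoint (i : Fin n) (w : ParamI) :
    n * (cellPoint n i w : ℝ) = (i : ℕ) + (w : ℝ) := by
  have := (cast_pos_of_neZero n).ne'
  simp only [cellPoint]
  field_simp

@[simp] theorem cellIndex_cellPoint (i : Fin n) (w : ParamI) : cellIndex n (cellPoint n i w) = i := by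
  ext
  simp only [cellIndex, mul_coe_cellPoint]
  rw [Nat.floor_eq_iff (add_nonneg (Nat.cast_nonneg _) w.2.1)]
  constructor <;> linarith [w.2.1, w.2.2]

@[simp] theorem cellFract_cellPoint (i : Fin n) (w : ParamI) : cellFract n (cellPoint n i w) = w := by
  ext
  simp only [cellFract, mul_coe_cellPoint]
  rw [Int.fract_natCast_add]
  exact Int.fract_eq_self.2 w.2

@[simp] theorem cellPoint_cellIndex (z : ParamI) : cellPoint n (cellIndex n z) (cellFract n z) = z := by
  have hn := cast_pos_of_neZero n
  ext
  simp only [cellIndex, cellFract, cellPoint]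
  rw [natCast_floor_eq_intCast_floor (mul_nonneg hn.le z.2.1), Int.floor_add_fract]
  field_simp

theorem measurable_cellIndex : Measurable (cellIndex n) := by
  refine measurable_to_countable' fun i => ?_
  have : cellIndex n ⁻¹' {i} = (fun z : ParamI => ⌊n * (z : ℝ)⌋₊) ⁻¹' {(i : ℕ)} := by
    ext z; simp [cellIndex, Fin.ext_iff]
  rw [this]
  exact (Nat.measurable_floor.comp (measurable_subtype_coe.const_mul _)) (measurableSet_singleton _)

theorem measurable_cellPoint : Measurable fun p : Fin n × ParamI => cellPoint n p.1 p.2 := by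
  refine Measurable.subtype_mk ?_
  have h : Measurable fun p : Fin n × ParamI => ((p.1 : ℕ) : ℝ) :=
    (measurable_of_countable fun i : Fin n => ((i : ℕ) : ℝ)).comp measurable_fst
  exact (h.add (measurable_subtype_coe.comp measurable_snd)).div_const _

theorem measurable_cellPoint_right (i : Fin n) : Measurable (cellPoint n i) :=
  (measurable_cellPoint n).comp measurable_prodMk_left

/-- `cellPoint n i` is a translation followed by a dilation by `1/n`, so pulling back multiplies
lengths by `n`. -/
theorem volume_preimage_cellPoint (i : Fin n) (S : Set ParamI) :
    volume (cellPoint n i ⁻¹' S) = n * volume (S ∩ cellIndex n ⁻¹' {i}) := by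
  have hn := cast_pos_of_neZero n
  have hvol : ∀ T : Set ParamI, volume T = volume (Subtype.val '' T : Set ℝ) := fun T =>
    comap_subtype_coe_apply measurableSet_Ico volume T
  rw [hvol, hvol]
  have : (Subtype.val '' (cellPoint n i ⁻¹' S) : Set ℝ) =
      (fun x => (i : ℝ) + x) ⁻¹' ((fun x => (n : ℝ)⁻¹ * x) ⁻¹'
        (Subtype.val '' (S ∩ cellIndex n ⁻¹' {i}) : Set ℝ)) := by
    ext w
    simp only [Set.mem_image, Set.mem_preimage, Set.mem_inter_iff, Set.mem_singleton_iff]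
    constructor
    · rintro ⟨w, hw, rfl⟩
      exact ⟨cellPoint n i w, ⟨hw, cellIndex_cellPoint n i w⟩, by simp [cellPoint]; ring⟩
    · rintro ⟨z, ⟨hz, rfl⟩, h⟩
      refine ⟨cellFract n z, by simpa using hz, ?_⟩
      have h2 := mul_coe_cellPoint n (cellIndex n z) (cellFract n z)
      rw [cellPoint_cellIndex] at h2
      have h3 : n * (z : ℝ) = ((cellIndex n z : ℕ) : ℝ) + w := by rw [h]; field_simp
      linarith
  rw [this, measure_preimage_add, Real.volume_preimage_mul_left (inv_ne_zero hn.ne'), inv_inv,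
    abs_of_pos hn, ENNReal.ofReal_natCast]

/-- Lebesgue measure is the average of its `n` affine copies on the cells. Both integration of step
functions and invariance under cell permutations reduce to this. -/
theorem volume_eq_sum_map_cellPoint :
    (volume : Measure ParamI) = ∑ i : Fin n, (n : ENNReal)⁻¹ • Measure.map (cellPoint n i) volume := by
  ext S hS
  rw [Measure.finsetSum_apply]
  have h1 : ∀ i : Fin n, ((n : ENNReal)⁻¹ • Measure.map (cellPoint n i) volume) S =
      volume (S ∩ cellIndex n ⁻¹' {i}) := fun i => by
    rw [Measure.smul_apply, Measure.map_apply (measurable_cellPoint_right n i) hS,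
      volume_preimage_cellPoint n i S, smul_eq_mul, ← mul_assoc, ENNReal.inv_mul_cancel, one_mul]
    · simpa using NeZero.ne n
    · simp
  simp_rw [h1]
  rw [← measure_biUnion_finset]
  · congr 1
    ext z; simp
  · intro i _ j _ hij
    refine Set.disjoint_left.2 fun z hz hz' => hij ?_
    rw [← hz.2, ← hz'.2]
  · exact fun i _ => hS.inter (measurable_cellIndex n (measurableSet_singleton i))

theorem integral_comp_cellIndex (f : Fin n → ℝ) :
    ∫ z, f (cellIndex n z) = (n : ℝ)⁻¹ * ∑ i, f i := by
  have hm : Measurable fun z => f (cellIndex n z) :=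
    (measurable_of_countable f).comp (measurable_cellIndex n)
  rw [volume_eq_sum_map_cellPoint n, integral_finsetSum_measure, Finset.mul_sum]
  · refine Finset.sum_congr rfl fun i _ => ?_
    rw [integral_smul_measure, integral_map (measurable_cellPoint_right n i).aemeasurable
      hm.aestronglyMeasurable]
    simp
  · intro i _
    refine Integrable.smul_measure ?_ (by simpa using NeZero.ne n)
    rw [integrable_map_measure hm.aestronglyMeasurable (measurable_cellPoint_right n i).aemeasurable]
    simp only [Function.comp_def, cellIndex_cellPoint]
    exact integrable_const _

theorem measurable_cellPoint_comp (p : Fin n → Fin n) :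
    Measurable fun z => cellPoint n (p (cellIndex n z)) (cellFract n z) := by
  have h : Measurable fun z => p (cellIndex n z) :=
    (measurable_of_countable p).comp (measurable_cellIndex n)
  exact (measurable_cellPoint n).comp (h.prodMk (measurable_cellFract n))

/-- The bijection of `[0,1)` that permutes the intervals `[i/n, (i+1)/n)`. -/
def cellPerm (p : Equiv.Perm (Fin n)) : ParamI ≃ᵐ ParamI where
  toFun z := cellPoint n (p (cellIndex n z)) (cellFract n z)
  invFun z := cellPoint n (p.symm (cellIndex n z)) (cellFract n z)
  left_inv z := by simp
  right_inv z := by simp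
  measurable_toFun := measurable_cellPoint_comp n p
  measurable_invFun := measurable_cellPoint_comp n p.symm

theorem cellPerm_apply (p : Equiv.Perm (Fin n)) (z : ParamI) :
    cellPerm n p z = cellPoint n (p (cellIndex n z)) (cellFract n z) := rfl

theorem measurePreserving_cellPerm (p : Equiv.Perm (Fin n)) :
    MeasurePreserving (cellPerm n p) volume volume := by
  refine ⟨(cellPerm n p).measurable, ?_⟩
  conv_lhs => rw [volume_eq_sum_map_cellPoint n]
  rw [← Measure.mapₗ_apply_of_measurable (cellPerm n p).measurable, map_sum]
  simp_rw [Measure.mapₗ_apply_of_measurable (cellPerm n p).measurable, Measure.map_smul]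
  have : ∀ i, Measure.map (cellPerm n p) (Measure.map (cellPoint n i) volume) =
      Measure.map (cellPoint n (p i)) volume := fun i => by
    rw [Measure.map_map (cellPerm n p).measurable (measurable_cellPoint_right n i)]
    congr 1
    ext w
    simp [cellPerm_apply]
  simp_rw [this]
  rw [Equiv.sum_comp p fun i => (n : ENNReal)⁻¹ • Measure.map (cellPoint n i) volume]
  exact (volume_eq_sum_map_cellPoint n).symm

theorem memLp_comp_cellIndex (x : Fin n → ℝ) :
    MemLp (fun z => x (cellIndex n z)) 2 (volume : Measure ParamI) := by
  refine MemLp.of_bound ((measurable_of_countable x).comp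
    (measurable_cellIndex n)).aestronglyMeasurable (∑ i, ‖x i‖) (ae_of_all _ fun z => ?_)
  exact Finset.single_le_sum (f := fun i => ‖x i‖) (fun _ _ => norm_nonneg _) (Finset.mem_univ _)

/-- The step function with value `x i` on `[i/n, (i+1)/n)`. -/
def stepFun : (Fin n → ℝ) →ₗ[ℝ] L2I where
  toFun x := (memLp_comp_cellIndex n x).toLp _
  map_add' x y := by rw [← MemLp.toLp_add]; rfl
  map_smul' a x := by rw [RingHom.id_apply, ← MemLp.toLp_const_smul]; rfl

theorem coeFn_stepFun (x : Fin n → ℝ) : stepFun n x =ᵐ[volume] fun z => x (cellIndex n z) :=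
  (memLp_comp_cellIndex n x).coeFn_toLp

theorem mean_stepFun (x : Fin n → ℝ) : mean (stepFun n x) = (n : ℝ)⁻¹ * ∑ i, x i := by
  rw [mean_apply, integral_congr_ae (coeFn_stepFun n x), integral_comp_cellIndex]

theorem norm_stepFun_sq (x : Fin n → ℝ) : ‖stepFun n x‖ ^ 2 = (n : ℝ)⁻¹ * ∑ i, x i ^ 2 := by
  rw [norm_sq_eq_integral, ← integral_comp_cellIndex n fun i => x i ^ 2]
  refine integral_congr_ae ?_
  filter_upwards [coeFn_stepFun n x] with z hz
  rw [hz]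

theorem norm_stepFun_sub_le {x x' y y' : Fin n → ℝ}
    (h : ∑ i, (y i - y' i) ^ 2 ≤ ∑ i, (x i - x' i) ^ 2) :
    ‖stepFun n y - stepFun n y'‖ ≤ ‖stepFun n x - stepFun n x'‖ := by
  refine abs_le_of_sq_le_sq' ?_ (norm_nonneg _) |>.2
  rw [← map_sub, ← map_sub, norm_stepFun_sq, norm_stepFun_sq]
  exact mul_le_mul_of_nonneg_left h (inv_nonneg.2 (Nat.cast_nonneg n))

/-- Translates the finite-dimensional orbit relation into the two symmetries under which `U` and the
potential energy are invariant. -/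
theorem stepFun_eq_of_orbitRel {x y : Fin n → ℝ} (h : OrbitRel x y) :
    ∃ (G : ParamI ≃ᵐ ParamI) (hG : MeasurePreserving G volume volume) (Z : L2I),
      IsIntegerValued Z ∧ stepFun n y = Lp.compMeasurePreserving G hG (stepFun n x) + Z := by
  obtain ⟨p, z, -, h⟩ := h
  refine ⟨cellPerm n p, measurePreserving_cellPerm n p, stepFun n fun i => z i, ?_, ?_⟩
  · filter_upwards [coeFn_stepFun n fun i => (z i : ℝ)] with w hw
    exact ⟨_, hw⟩
  · have : stepFun n (x ∘ p) = Lp.compMeasurePreserving (cellPerm n p)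
        (measurePreserving_cellPerm n p) (stepFun n x) := by
      refine Lp.ext ?_
      filter_upwards [coeFn_stepFun n (x ∘ p),
        Lp.coeFn_compMeasurePreserving (stepFun n x) (measurePreserving_cellPerm n p),
        (measurePreserving_cellPerm n p).quasiMeasurePreserving.ae_eq_comp (coeFn_stepFun n x)]
        with w h1 h2 h3
      rw [h1, h2, h3]
      simp [cellPerm_apply]
    rw [← this, ← map_add]
    congr 1
    exact funext h

/-- The orthogonal projection onto the step functions on `[0,1)` with `n` steps. -/
def stepProj : L2I →L[ℝ] L2I := (LinearMap.range (stepFun n)).starProjection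

theorem exists_stepProj_eq (M : L2I) : ∃ x, stepFun n x = stepProj n M :=
  Submodule.starProjection_apply_mem (LinearMap.range (stepFun n)) M

theorem norm_stepProj_le (M : L2I) : ‖stepProj n M‖ ≤ ‖M‖ :=
  Submodule.norm_starProjection_apply_le _ M

theorem norm_sub_stepProj_le (M : L2I) (x : Fin n → ℝ) : ‖M - stepProj n M‖ ≤ ‖M - stepFun n x‖ := by
  rw [stepProj, Submodule.starProjection_minimal]
  exact ciInf_le (f := fun y : LinearMap.range (stepFun n) => ‖M - y‖)
    ⟨0, by rintro _ ⟨y, rfl⟩; exact norm_nonneg _⟩ ⟨stepFun n x, x, rfl⟩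

/-- The mean is the inner product with the constant 1, which is itself a step function and so is
fixed by the self-adjoint projection. -/
theorem mean_stepProj (M : L2I) : mean (stepProj n M) = mean M := by
  have h1 : indicatorConstLp 2 (μ := (volume : Measure ParamI)) MeasurableSet.univ
      (measure_ne_top _ _) (1 : ℝ) = stepFun n fun _ => 1 := by
    refine Lp.ext ?_
    filter_upwards [coeFn_stepFun n fun _ => (1 : ℝ), indicatorConstLp_coeFn (p := 2)
      (hs := MeasurableSet.univ) (hμs := measure_ne_top (volume : Measure ParamI) _) (c := (1 : ℝ))]
      with z h1 h2
    rw [h1, h2]; simp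
  simp only [mean, innerSL_apply_apply, h1, stepProj]
  rw [← Submodule.inner_starProjection_left_eq_right, Submodule.starProjection_eq_self_iff.2
    (LinearMap.mem_range_self _ _)]

theorem abs_sub_cellPoint_le (z : ParamI) :
    |(z : ℝ) - cellPoint n (cellIndex n z) ParamI.left| ≤ (n : ℝ)⁻¹ := by
  have hn := cast_pos_of_neZero n
  have h1 : n * ((z : ℝ) - cellPoint n (cellIndex n z) ParamI.left) = cellFract n z := by
    have h2 := mul_coe_cellPoint n (cellIndex n z) (cellFract n z)
    rw [cellPoint_cellIndex] at h2
    rw [mul_sub, mul_coe_cellPoint, h2]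
    simp [ParamI.left]
  have h2 : (z : ℝ) - cellPoint n (cellIndex n z) ParamI.left = (n : ℝ)⁻¹ * cellFract n z := by
    rw [← h1]; field_simp
  rw [h2, abs_of_nonneg (mul_nonneg (inv_nonneg.2 hn.le) (cellFract n z).2.1)]
  exact mul_le_of_le_one_right (inv_nonneg.2 hn.le) (cellFract n z).2.2.le

end Cells

/-- The projection is the best approximation by step functions. It therefore suffices to approximate
`M` by a compactly supported continuous function, which is uniformly continuous, and to sample that
function at the left ends of the cells. -/
theorem tendsto_stepProj (M : L2I) : Tendsto (fun k : ℕ => stepProj (k + 1) M) atTop (𝓝 M) := by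
  rw [Metric.tendsto_atTop]
  intro ε hε
  have hε3 : ENNReal.ofReal (ε / 3) ≠ 0 := by simpa using by positivity
  obtain ⟨g, hgs, hgM, hgc, hg⟩ :=
    (Lp.memLp M).exists_hasCompactSupport_eLpNorm_sub_le (by norm_num) hε3
  have h1 : ‖M - hg.toLp g‖ ≤ ε / 3 := by
    rw [Lp.norm_def]
    refine ENNReal.toReal_le_of_le_ofReal (by positivity) (le_trans (le_of_eq ?_) hgM)
    refine eLpNorm_congr_ae ?_
    filter_upwards [Lp.coeFn_sub M (hg.toLp g), hg.coeFn_toLp] with z h1 h2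
    rw [h1, Pi.sub_apply, h2, Pi.sub_apply]
  obtain ⟨δ, hδ, hgδ⟩ := Metric.uniformContinuous_iff.1
    (hgs.uniformContinuous_of_continuous hgc) (ε / 3) (by positivity)
  obtain ⟨N, hN⟩ := exists_nat_one_div_lt hδ
  refine ⟨N, fun k hk => ?_⟩
  rw [dist_comm, dist_eq_norm]
  refine (norm_sub_stepProj_le (k + 1) M fun i => g (cellPoint (k + 1) i ParamI.left)).trans_lt ?_
  have h2 : ‖hg.toLp g - stepFun (k + 1) fun i => g (cellPoint (k + 1) i ParamI.left)‖ ≤ ε / 3 := by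
    refine norm_le_of_ae_bound (by positivity) ?_
    filter_upwards [Lp.coeFn_sub (hg.toLp g)
      (stepFun (k + 1) fun i => g (cellPoint (k + 1) i ParamI.left)), hg.coeFn_toLp,
      coeFn_stepFun (k + 1) fun i => g (cellPoint (k + 1) i ParamI.left)] with z h1 h2 h3
    rw [h1, Pi.sub_apply, h2, h3, ← dist_eq_norm]
    refine (hgδ ?_).le
    rw [Subtype.dist_eq, Real.dist_eq]
    refine (abs_sub_cellPoint_le (k + 1) z).trans_lt (lt_of_le_of_lt ?_ hN)
    rw [one_div]
    push_cast
    have : (N : ℝ) ≤ k := by exact_mod_cast hk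
    gcongr
  calc _ = ‖(M - hg.toLp g) + (hg.toLp g -
        stepFun (k + 1) fun i => g (cellPoint (k + 1) i ParamI.left))‖ := by congr 1; abel
    _ ≤ ε / 3 + ε / 3 := (norm_add_le _ _).trans (add_le_add h1 h2)
    _ < ε := by linarith

/-! ### Approximation, closedness and compactness of `Mon`. -/

theorem monotone_cellIndex (n : ℕ) [NeZero n] : Monotone (cellIndex n) := fun z w h => by
  have h' : (z : ℝ) ≤ w := h
  exact Fin.mk_le_mk.2 (Nat.floor_mono (by gcongr))

theorem ParamI.left_le (z : ParamI) : ParamI.left ≤ z := z.2.1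

theorem IsMonVec.isMon_stepFun {n : ℕ} [NeZero n] {x : Fin n → ℝ} (hx : IsMonVec x) :
    IsMon (stepFun n x) :=
  ⟨fun z => x (cellIndex n z), hx.monotone.comp (monotone_cellIndex n),
    fun _ => hx.le_add_one _ _, coeFn_stepFun n x⟩

/-- On each cell the error of sampling at the left end is at most the increment of `f` between
sample points. These increments are nonnegative with sum 1, so each dominates its own square and the
squared error integrates to at most `1/n`, uniformly over `Mon`. -/
theorem IsMon.exists_stepFun {M : L2I} (hM : IsMon M) (n : ℕ) [NeZero n] :
    ∃ x, IsMonVec x ∧ ‖M - stepFun n x‖ ^ 2 ≤ (n : ℝ)⁻¹ := by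
  obtain ⟨f, hf, hf1, hMf⟩ := hM
  have hn := cast_pos_of_neZero n
  -- The value `f(0) + 1` beyond the last cell bounds `f` there and makes the increments telescope
  -- to exactly 1.
  let X : ℕ → ℝ := fun j =>
    if h : j < n then f (cellPoint n ⟨j, h⟩ ParamI.left) else f ParamI.left + 1
  have hXi : ∀ i : Fin n, X i = f (cellPoint n i ParamI.left) := fun i => dif_pos i.2
  have hX0 : X 0 = f ParamI.left := by
    have h : cellPoint n ⟨0, Nat.pos_of_ne_zero (NeZero.ne n)⟩ ParamI.left = ParamI.left := by
      ext; simp [cellPoint, ParamI.left]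
    simp only [X, dif_pos (Nat.pos_of_ne_zero (NeZero.ne n)), h]
  have hXn : X n = f ParamI.left + 1 := dif_neg (lt_irrefl n)
  have hlow : ∀ z, X (cellIndex n z) ≤ f z := fun z => by
    rw [hXi]
    refine hf ?_
    show ((cellIndex n z : ℕ) + ((ParamI.left : ParamI) : ℝ)) / n ≤ z
    rw [div_le_iff₀ hn, mul_comm, show ((ParamI.left : ParamI) : ℝ) = 0 from rfl, add_zero]
    exact Nat.floor_le (mul_nonneg hn.le z.2.1)
  have hup : ∀ z, f z ≤ X (cellIndex n z + 1) := fun z => by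
    by_cases h : (cellIndex n z : ℕ) + 1 < n
    · simp only [X, dif_pos h]
      refine hf ?_
      show (z : ℝ) ≤ (((cellIndex n z : ℕ) + 1 : ℕ) + ((ParamI.left : ParamI) : ℝ)) / n
      rw [le_div_iff₀ hn, mul_comm, show ((ParamI.left : ParamI) : ℝ) = 0 from rfl, add_zero]
      push_cast
      exact (Nat.lt_floor_add_one _).le
    · simp only [X, dif_neg h]
      exact hf1 z
  have hmono : ∀ i : Fin n, 0 ≤ X (i + 1) - X i := fun i => by
    have h1 := hlow (cellPoint n i ParamI.left)
    have h2 := hup (cellPoint n i ParamI.left)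
    rw [cellIndex_cellPoint] at h1 h2
    linarith
  have hsum : ∑ i : Fin n, (X (i + 1) - X i) = 1 := by
    rw [Fin.sum_univ_eq_sum_range (fun j => X (j + 1) - X j), Finset.sum_range_sub, hXn, hX0]
    ring
  have hle1 : ∀ i : Fin n, X (i + 1) - X i ≤ 1 := fun i => by
    rw [← hsum]
    exact Finset.single_le_sum (f := fun i : Fin n => X (i + 1) - X i) (fun j _ => hmono j)
      (Finset.mem_univ i)
  refine ⟨fun i => X i, ⟨fun i j hij => ?_, fun i j => ?_⟩, ?_⟩
  · simp only [hXi]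
    refine hf ?_
    show ((i : ℕ) + _ : ℝ) / n ≤ ((j : ℕ) + _ : ℝ) / n
    have : ((i : ℕ) : ℝ) ≤ (j : ℕ) := by exact_mod_cast hij
    gcongr
  · simp only [hXi]
    linarith [hf1 (cellPoint n j ParamI.left), hf (ParamI.left_le (cellPoint n i ParamI.left))]
  · rw [norm_sq_eq_integral]
    calc ∫ z, (M - stepFun n fun i => X i : L2I) z ^ 2
        ≤ ∫ z, (X ((cellIndex n z : ℕ) + 1) - X (cellIndex n z)) := by
          refine integral_mono_ae (Lp.memLp _).integrable_sq
            ((memLp_comp_cellIndex n fun i => X (i + 1) - X i).integrable (by norm_num)) ?_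
          filter_upwards [Lp.coeFn_sub M (stepFun n fun i => X i), hMf,
            coeFn_stepFun n fun i => X i] with z h1 h2 h3
          rw [h1, Pi.sub_apply, h2, h3]
          have := hlow z
          have := hup z
          have := hle1 (cellIndex n z)
          nlinarith
      _ = (n : ℝ)⁻¹ := by
          rw [integral_comp_cellIndex n fun i : Fin n => X (i + 1) - X i, hsum, mul_one]

/-- Along a subsequence converging almost everywhere, both inequalities pass to the limit on a set
`D` of full measure. The infimum of `M` over the points of `D` to the right of `x` extends the limit
monotonically to every `x`. -/
theorem isClosed_isMon : IsClosed {M | IsMon M} := by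
  refine IsSeqClosed.isClosed fun u M hu hM => ?_
  obtain ⟨φ, -, hφ⟩ := (tendstoInMeasure_of_tendsto_Lp hM).exists_seq_tendsto_ae
  choose f hf hf1 hfu using hu
  have hae : ∀ᵐ z, Tendsto (fun k => f (φ k) z) atTop (𝓝 (M z)) := by
    filter_upwards [hφ, ae_all_iff.2 fun k => hfu (φ k)] with z h1 h2
    simpa only [← h2] using h1
  set D : Set ParamI := {z | Tendsto (fun k => f (φ k) z) atTop (𝓝 (M z))} with hD
  have hmono : ∀ x ∈ D, ∀ y ∈ D, x ≤ y → M x ≤ M y := fun x hx y hy hxy =>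
    le_of_tendsto_of_tendsto' hx hy fun k => hf _ hxy
  have hone : ∀ x ∈ D, ∀ y ∈ D, M x ≤ M y + 1 := fun x hx y hy =>
    le_of_tendsto_of_tendsto' hx (hy.add_const 1) fun k =>
      (hf1 _ x).trans (add_le_add_left (hf _ (ParamI.left_le y)) _)
  -- The interval `[x,1)` has positive length, so it cannot miss a set of full measure.
  have hne : ∀ x : ParamI, ∃ y ∈ D, x ≤ y := by
    intro x
    by_contra! h
    have h0 : volume (Set.Ici x) = 0 := by
      have hD0 : volume Dᶜ = 0 := ae_iff.1 hae
      exact measure_mono_null (fun y hy hyD => not_le.2 (h y hyD) hy) hD0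
    have h1 : volume (Set.Ici x) = volume (Subtype.val '' Set.Ici x : Set ℝ) :=
      comap_subtype_coe_apply measurableSet_Ico volume _
    have h2 : (Subtype.val '' Set.Ici x : Set ℝ) = Set.Ico (x : ℝ) 1 := by
      ext w
      constructor
      · rintro ⟨w, hw, rfl⟩
        exact ⟨hw, w.2.2⟩
      · rintro ⟨hw, hw1⟩
        exact ⟨⟨w, x.2.1.trans hw, hw1⟩, hw, rfl⟩
    rw [h1, h2, Real.volume_Ico, ENNReal.ofReal_eq_zero] at h0
    linarith [x.2.2]
  obtain ⟨y₀, hy₀, -⟩ := hne ParamI.left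
  have hbdd : ∀ x : ParamI, BddBelow (M '' {y | y ∈ D ∧ x ≤ y}) := fun x =>
    ⟨M y₀ - 1, by rintro _ ⟨y, hy, rfl⟩; linarith [hone y₀ hy₀ y hy.1]⟩
  have hnonempty : ∀ x : ParamI, (M '' {y | y ∈ D ∧ x ≤ y}).Nonempty := fun x =>
    let ⟨y, hy, hxy⟩ := hne x
    ⟨_, y, ⟨hy, hxy⟩, rfl⟩
  refine ⟨fun x => sInf (M '' {y | y ∈ D ∧ x ≤ y}), fun x y hxy => ?_, fun x => ?_, ?_⟩
  · exact csInf_le_csInf (hbdd x) (hnonempty y)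
      (Set.image_mono fun w hw => ⟨hw.1, hxy.trans hw.2⟩)
  · obtain ⟨y, hy, hxy⟩ := hne x
    refine (csInf_le (hbdd x) ⟨y, ⟨hy, hxy⟩, rfl⟩).trans ?_
    rw [← sub_le_iff_le_add]
    refine le_csInf (hnonempty _) ?_
    rintro _ ⟨w, hw, rfl⟩
    linarith [hone y hy w hw.1]
  · filter_upwards [hae] with x hx
    refine le_antisymm (le_csInf (hnonempty _) ?_) (csInf_le (hbdd x) ⟨x, ⟨hx, le_rfl⟩, rfl⟩)
    rintro _ ⟨w, hw, rfl⟩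
    exact hmono x hx w hw.1 hw.2

/-- The uniform approximation rate of `IsMon.exists_stepFun` places the set within `ε/2` of a
compact ball of a finite-dimensional space; with completeness this gives compactness. -/
theorem isCompact_isMon (C : ℝ) : IsCompact {M | IsMon M ∧ ‖M‖ ≤ C} := by
  refine isCompact_iff_totallyBounded_isComplete.2 ⟨Metric.totallyBounded_iff.2 fun ε hε => ?_,
    (isClosed_isMon.inter (isClosed_le continuous_norm continuous_const)).isComplete⟩
  obtain ⟨k, hk⟩ := exists_nat_one_div_lt (show 0 < min 1 ((ε / 2) ^ 2) by positivity)
  have hstep : ∀ M, IsMon M → ∃ x, ‖M - stepFun (k + 1) x‖ < min 1 (ε / 2) := by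
    intro M hM
    obtain ⟨x, -, hx⟩ := hM.exists_stepFun (k + 1)
    rw [← one_div] at hx
    push_cast at hx
    have h := hx.trans_lt hk
    refine ⟨x, lt_min ?_ ?_⟩
    · have := h.trans_le (min_le_left _ _)
      nlinarith [norm_nonneg (M - stepFun (k + 1) x)]
    · exact lt_of_pow_lt_pow_left₀ 2 (by positivity) (h.trans_le (min_le_right _ _))
  have hcomp : IsCompact (Subtype.val '' (Metric.closedBall 0 (C + 1) :
      Set (LinearMap.range (stepFun (k + 1)))) : Set L2I) := by
    have : ProperSpace (LinearMap.range (stepFun (k + 1))) := FiniteDimensional.proper ℝ _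
    exact (isCompact_closedBall _ _).image continuous_subtype_val
  obtain ⟨t, ht, hcov⟩ := Metric.totallyBounded_iff.1 hcomp.totallyBounded (ε / 2) (by positivity)
  refine ⟨t, ht, fun M hM => ?_⟩
  obtain ⟨x, hx⟩ := hstep M hM.1
  have hxC : ‖stepFun (k + 1) x‖ ≤ C + 1 := by
    have h1 := norm_sub_norm_le (stepFun (k + 1) x) M
    rw [norm_sub_rev] at h1
    linarith [hM.2, hx.trans_le (min_le_left _ _)]
  have h2 := hcov ⟨⟨stepFun (k + 1) x, LinearMap.mem_range_self _ x⟩,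
    by simpa [Metric.mem_closedBall, dist_zero_right] using hxC, rfl⟩
  simp only [Set.mem_iUnion, exists_prop] at h2 ⊢
  obtain ⟨y, hy, hxy⟩ := h2
  refine ⟨y, hy, ?_⟩
  rw [Metric.mem_ball] at hxy ⊢
  rw [← dist_eq_norm] at hx
  have := dist_triangle M (stepFun (k + 1) x) y
  linarith [hx.trans_le (min_le_right _ _)]

/-! ### Boundedness of invariant continuous functions. -/

namespace IsInvariantContinuous

variable {U : L2I → ℝ}

theorem stepFun_eq (hU : IsInvariantContinuous U) {n : ℕ} [NeZero n] {x y : Fin n → ℝ}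
    (h : OrbitRel x y) :
    U (stepFun n y) = U (stepFun n x) := by
  obtain ⟨G, hG, Z, hZ, h⟩ := stepFun_eq_of_orbitRel n h
  rw [h, hU.translation _ _ hZ, hU.rearrangement]

/-- Sorting and subtracting an integer constant bring every step function, without change of `U`, to
an element of `Mon` with values in `[0,2)`. Those elements lie in a compact set, and step functions
are dense. -/
theorem exists_bound (hU : IsInvariantContinuous U) : ∃ B, ∀ M, |U M| ≤ B := by
  obtain ⟨B, hB⟩ := (isCompact_isMon 2).exists_bound_of_continuousOn hU.continuous.continuousOn
  refine ⟨B, fun M => ?_⟩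
  have hstep : ∀ (n : ℕ) [NeZero n] (x : Fin n → ℝ), |U (stepFun n x)| ≤ B := by
    intro n _ x
    obtain ⟨y, hxy, hy⟩ := exists_isMonVec_orbitRel x
    rw [← hU.stepFun_eq hxy]
    let k : ℤ := ⌊y 0⌋
    have hZ : IsIntegerValued (stepFun n fun _ => -(k : ℝ)) := by
      filter_upwards [coeFn_stepFun n fun _ => -(k : ℝ)] with z hz
      exact ⟨-k, by rw [hz]; push_cast; rfl⟩
    rw [← hU.translation _ _ hZ, ← map_add]
    refine hB _ ⟨IsMonVec.isMon_stepFun ⟨fun i j hij => ?_, fun i j => ?_⟩, ?_⟩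
    · exact add_le_add_left (hy.monotone hij) _
    · have := hy.le_add_one i j
      simp only [Pi.add_apply]
      linarith
    · refine norm_le_of_ae_bound (by norm_num) ?_
      filter_upwards [coeFn_stepFun n (y + fun _ => -(k : ℝ))] with z hz
      rw [hz, Pi.add_apply, Real.norm_eq_abs, abs_le]
      have h1 := Int.floor_le (y 0)
      have h2 := Int.lt_floor_add_one (y 0)
      have h3 := hy.le_add_one 0 (cellIndex n z)
      have h4 := hy.monotone (Fin.zero_le (cellIndex n z))
      constructor <;> linarith
  refine le_of_tendsto ((hU.continuous.tendsto M).comp (tendsto_stepProj M)).abs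
    (Eventually.of_forall fun k => ?_)
  obtain ⟨x, hx⟩ := exists_stepProj_eq (k + 1) M
  simp only [Function.comp_apply, ← hx]
  exact hstep _ x

end IsInvariantContinuous

/-! ### The potential energy: bounds, Lipschitz continuity, invariance. -/

theorem exists_bound_of_periodic {E : Type*} [NormedAddCommGroup E] {F : ℝ × ℝ → E}
    (hF : Continuous F) (h1 : ∀ t x, F (t + 1, x) = F (t, x)) (h2 : ∀ t x, F (t, x + 1) = F (t, x)) :
    ∃ C, ∀ p, ‖F p‖ ≤ C := by
  obtain ⟨C, hC⟩ := ((isCompact_Icc (a := (0 : ℝ)) (b := 1)).prod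
    (isCompact_Icc (a := (0 : ℝ)) (b := 1))).exists_bound_of_continuousOn hF.continuousOn
  refine ⟨C, fun ⟨t, x⟩ => ?_⟩
  have e1 : F (t, x) = F (Int.fract t, x) := by
    have : Function.Periodic (fun t => F (t, x)) 1 := fun t => h1 t x
    have := this.sub_zsmul_eq (x := t) ⌊t⌋
    rw [← this, zsmul_one, Int.self_sub_floor]
  have e2 : F (Int.fract t, x) = F (Int.fract t, Int.fract x) := by
    have : Function.Periodic (fun x => F (Int.fract t, x)) 1 := fun x => h2 _ x
    have := this.sub_zsmul_eq (x := x) ⌊x⌋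
    rw [← this, zsmul_one, Int.self_sub_floor]
  rw [e1, e2]
  exact hC _ ⟨⟨Int.fract_nonneg _, (Int.fract_lt_one _).le⟩, Int.fract_nonneg _,
    (Int.fract_lt_one _).le⟩

theorem exists_lipschitz_of_periodic {F : ℝ → ℝ → ℝ}
    (hF : ContDiff ℝ 1 (Function.uncurry F)) (h1 : ∀ t x, F (t + 1) x = F t x)
    (h2 : ∀ t x, F t (x + 1) = F t x) :
    ∃ K, 0 ≤ K ∧ ∀ t x s y, |F t x - F s y| ≤ K * (|t - s| + |x - y|) := by
  obtain ⟨C, hC⟩ := exists_bound_of_periodic (F := fderiv ℝ (Function.uncurry F))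
    (hF.continuous_fderiv one_ne_zero)
    (fun t x => by
      rw [show ((t + 1, x) : ℝ × ℝ) = (t, x) + (1, 0) by simp, ← fderiv_comp_add_right]
      congr 1
      ext ⟨t, x⟩
      simp [Function.uncurry, h1])
    (fun t x => by
      rw [show ((t, x + 1) : ℝ × ℝ) = (t, x) + (0, 1) by simp, ← fderiv_comp_add_right]
      congr 1
      ext ⟨t, x⟩
      simp [Function.uncurry, h2])
  have hC0 : 0 ≤ C := (norm_nonneg _).trans (hC 0)
  refine ⟨C, hC0, fun t x s y => ?_⟩
  have := convex_univ.norm_image_sub_le_of_norm_fderiv_le (𝕜 := ℝ) (f := Function.uncurry F)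
    (x := (s, y)) (y := (t, x)) (fun p _ => hF.differentiable one_ne_zero p) (fun p _ => hC p)
    (Set.mem_univ _) (Set.mem_univ _)
  refine this.trans (mul_le_mul_of_nonneg_left ?_ hC0)
  rw [Prod.mk_sub_mk, Prod.norm_def]
  exact max_le (le_add_of_nonneg_right (abs_nonneg _)) (le_add_of_nonneg_left (abs_nonneg _))

/-- The total potential energy. -/
def potential (V : ℝ → ℝ → ℝ) (W : ℝ → ℝ) (t : ℝ) (M : L2I) : ℝ :=
  externalEnergy V t M + interactionEnergy W M

theorem lagrangianC_eq (V : ℝ → ℝ → ℝ) (W : ℝ → ℝ) (c t : ℝ) (M N : L2I) :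
    lagrangianC V W c t M N = (1 / 2) * ‖N‖ ^ 2 - potential V W t M - c * mean N := by
  rw [lagrangianC, lagrangian, potential, integral_const_mul, mean_apply]
  ring

theorem add_zsmul_periodic {f : ℝ → ℝ} (hf : ∀ x, f (x + 1) = f x) (x : ℝ) (k : ℤ) :
    f (x + k) = f x := by
  have := Function.Periodic.zsmul (f := f) hf k x
  simpa using this

theorem potential_comp (V : ℝ → ℝ → ℝ) (W : ℝ → ℝ) (t : ℝ) (M : L2I) (G : ParamI ≃ᵐ ParamI)
    (hG : MeasurePreserving G volume volume) :
    potential V W t (Lp.compMeasurePreserving G hG M) = potential V W t M := by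
  have hz := Lp.coeFn_compMeasurePreserving M hG
  rw [potential, potential, externalEnergy, externalEnergy, interactionEnergy, interactionEnergy]
  congr 1
  · rw [← hG.integral_comp' fun z => V t (M z)]
    refine integral_congr_ae ?_
    filter_upwards [hz] with z hz
    rw [hz, Function.comp_apply]
  · congr 1
    have hGG : MeasurePreserving (G.prodCongr G) (volume.prod volume) (volume.prod volume) :=
      hG.prod hG
    rw [Measure.volume_eq_prod, ← hGG.integral_comp' fun p => W (M p.1 - M p.2)]
    refine integral_congr_ae ?_
    filter_upwards [Measure.quasiMeasurePreserving_fst.ae hz,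
      Measure.quasiMeasurePreserving_snd.ae hz] with p h1 h2
    rw [h1, h2]
    rfl

namespace IsPotentialPair

variable {V : ℝ → ℝ → ℝ} {W : ℝ → ℝ}

theorem continuous_V (h : IsPotentialPair V W) (t : ℝ) : Continuous (V t) :=
  h.contDiff_V.continuous.comp (by fun_prop : Continuous fun x : ℝ => (t, x))

theorem aestronglyMeasurable_V (h : IsPotentialPair V W) (t : ℝ) (M : L2I) :
    AEStronglyMeasurable (fun z => V t (M z)) volume :=
  (h.continuous_V t).comp_aestronglyMeasurable (Lp.aestronglyMeasurable M)

theorem aestronglyMeasurable_W (h : IsPotentialPair V W) (M : L2I) :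
    AEStronglyMeasurable (fun p : ParamI × ParamI => W (M p.1 - M p.2)) volume :=
  h.contDiff_W.continuous.comp_aestronglyMeasurable
    ((Lp.aestronglyMeasurable M).comp_fst.sub (Lp.aestronglyMeasurable M).comp_snd)

theorem exists_potential_bound (h : IsPotentialPair V W) :
    ∃ B, 0 ≤ B ∧ ∀ t M, |potential V W t M| ≤ B := by
  obtain ⟨C, hC⟩ := exists_bound_of_periodic h.contDiff_V.continuous h.periodic_time_V
    h.periodic_space_V
  obtain ⟨D, hD⟩ := exists_bound_of_periodic (F := fun p => W p.2)
    (h.contDiff_W.continuous.comp continuous_snd) (fun _ _ => rfl) (fun _ => h.periodic_W)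
  have hbound : ∀ t M, |potential V W t M| ≤ C + D := by
    intro t M
    have h1 : ‖∫ z, V t (M z)‖ ≤ C := by
      refine (norm_integral_le_of_norm_le_const (ae_of_all _ fun z => hC (t, M z))).trans ?_
      simp
    have h2 : ‖∫ p : ParamI × ParamI, W (M p.1 - M p.2)‖ ≤ D := by
      refine (norm_integral_le_of_norm_le_const (ae_of_all _ fun p : ParamI × ParamI =>
        hD (0, M p.1 - M p.2))).trans ?_
      simp [Measure.volume_eq_prod]
    rw [Real.norm_eq_abs, abs_le] at h1 h2
    rw [potential, externalEnergy, interactionEnergy, abs_le]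
    constructor <;> linarith
  exact ⟨C + D, (abs_nonneg _).trans (hbound 0 0), hbound⟩

theorem integrable_V (h : IsPotentialPair V W) (t : ℝ) (M : L2I) :
    Integrable fun z => V t (M z) := by
  obtain ⟨C, hC⟩ := exists_bound_of_periodic h.contDiff_V.continuous h.periodic_time_V
    h.periodic_space_V
  exact Integrable.of_bound (h.aestronglyMeasurable_V t M) C (ae_of_all _ fun z => hC (t, M z))

theorem integrable_W (h : IsPotentialPair V W) (M : L2I) :
    Integrable (fun p : ParamI × ParamI => W (M p.1 - M p.2)) volume := by
  obtain ⟨D, hD⟩ := exists_bound_of_periodic (F := fun p => W p.2)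
    (h.contDiff_W.continuous.comp continuous_snd) (fun _ _ => rfl) (fun _ => h.periodic_W)
  exact Integrable.of_bound (h.aestronglyMeasurable_W M) D
    (ae_of_all _ fun p => hD (0, M p.1 - M p.2))

/-- The periodic derivatives are bounded, and the `L¹` norm is at most the `L²` norm on a
probability space. The two arguments of `W` give a factor 2, which the factor 1/2 in the interaction
energy cancels. -/
theorem exists_potential_lipschitz (h : IsPotentialPair V W) :
    ∃ K, 0 ≤ K ∧ ∀ t s M N, |potential V W t M - potential V W s N| ≤ K * (|t - s| + ‖M - N‖) := by
  obtain ⟨C, hC0, hC⟩ := exists_lipschitz_of_periodic (h.contDiff_V.of_le (by norm_num))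
    h.periodic_time_V h.periodic_space_V
  obtain ⟨D, hD0, hD⟩ := exists_lipschitz_of_periodic (F := fun _ => W)
    ((h.contDiff_W.comp contDiff_snd).of_le (by norm_num)) (fun _ _ => rfl) (fun _ => h.periodic_W)
  refine ⟨C + D, by positivity, fun t s M N => ?_⟩
  have hsub : ∀ᵐ z, |M z - N z| = |(M - N) z| := by
    filter_upwards [Lp.coeFn_sub M N] with z hz
    rw [hz, Pi.sub_apply]
  have hint : Integrable fun z => |M z - N z| := ((integrable_coe M).sub (integrable_coe N)).abs
  have hle : ∫ z, |M z - N z| ≤ ‖M - N‖ :=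
    (integral_congr_ae hsub).trans_le (abs_integral_le_norm _)
  have h1 : |(∫ z, V t (M z)) - ∫ z, V s (N z)| ≤ C * (|t - s| + ‖M - N‖) := by
    rw [← integral_sub (h.integrable_V t M) (h.integrable_V s N)]
    calc |∫ z, (V t (M z) - V s (N z))| ≤ ∫ z, |V t (M z) - V s (N z)| := abs_integral_le_integral_abs
      _ ≤ ∫ z, C * (|t - s| + |M z - N z|) :=
        integral_mono ((h.integrable_V t M).sub (h.integrable_V s N)).abs
          (((integrable_const _).add hint).const_mul _) fun z => hC _ _ _ _
      _ = C * (|t - s| + ∫ z, |M z - N z|) := by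
        rw [integral_const_mul, integral_add (integrable_const _) hint]; simp
      _ ≤ _ := by gcongr
  have h2 : |(∫ p : ParamI × ParamI, W (M p.1 - M p.2)) -
      ∫ p : ParamI × ParamI, W (N p.1 - N p.2)| ≤ D * (2 * ‖M - N‖) := by
    rw [← integral_sub (h.integrable_W M) (h.integrable_W N)]
    have hi1 : Integrable (fun p : ParamI × ParamI => |M p.1 - N p.1|) volume := hint.comp_fst _
    have hi2 : Integrable (fun p : ParamI × ParamI => |M p.2 - N p.2|) volume := hint.comp_snd _
    calc _ ≤ ∫ p : ParamI × ParamI, |W (M p.1 - M p.2) - W (N p.1 - N p.2)| :=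
          abs_integral_le_integral_abs
      _ ≤ ∫ p : ParamI × ParamI, D * (|M p.1 - N p.1| + |M p.2 - N p.2|) :=
        integral_mono ((h.integrable_W M).sub (h.integrable_W N)).abs ((hi1.add hi2).const_mul _)
          fun p => (hD 0 _ 0 _).trans (mul_le_mul_of_nonneg_left (by
            rw [sub_self, abs_zero, zero_add,
              show M p.1 - M p.2 - (N p.1 - N p.2) = (M p.1 - N p.1) - (M p.2 - N p.2) by ring]
            exact abs_sub _ _) hD0)
      _ = D * (2 * ∫ z, |M z - N z|) := by
        rw [integral_const_mul, integral_add hi1 hi2, Measure.volume_eq_prod,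
          integral_fun_fst fun z => |M z - N z|, integral_fun_snd fun z => |M z - N z|]
        simp [two_mul]
      _ ≤ _ := by gcongr
  simp only [potential, externalEnergy, interactionEnergy]
  rw [abs_le] at h1 h2 ⊢
  have := mul_nonneg hD0 (abs_nonneg (t - s))
  constructor <;> nlinarith

theorem potential_add (h : IsPotentialPair V W) (t : ℝ) (M : L2I) {Z : L2I}
    (hZ : IsIntegerValued Z) : potential V W t (M + Z) = potential V W t M := by
  have hz : ∀ᵐ z, ∃ k : ℤ, (M + Z) z = M z + k := by
    filter_upwards [Lp.coeFn_add M Z, hZ] with z h1 ⟨k, h2⟩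
    exact ⟨k, by rw [h1, Pi.add_apply, h2]⟩
  rw [potential, potential, externalEnergy, externalEnergy, interactionEnergy, interactionEnergy]
  congr 1
  · refine integral_congr_ae ?_
    filter_upwards [hz] with z ⟨k, hk⟩
    rw [hk, add_zsmul_periodic (h.periodic_space_V t)]
  · congr 1
    refine integral_congr_ae ?_
    filter_upwards [Measure.quasiMeasurePreserving_fst.ae hz,
      Measure.quasiMeasurePreserving_snd.ae hz] with p ⟨k, hk⟩ ⟨l, hl⟩
    rw [hk, hl, show M p.1 + k - (M p.2 + l) = M p.1 - M p.2 + ((k - l : ℤ) : ℝ) by push_cast; ring,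
      add_zsmul_periodic h.periodic_W]

theorem potential_stepFun (h : IsPotentialPair V W) (t : ℝ) {n : ℕ} [NeZero n] {x y : Fin n → ℝ}
    (hxy : OrbitRel x y) : potential V W t (stepFun n y) = potential V W t (stepFun n x) := by
  obtain ⟨G, hG, Z, hZ, e⟩ := stepFun_eq_of_orbitRel n hxy
  rw [e, h.potential_add _ _ hZ, potential_comp]

end IsPotentialPair

/-! ### Distributional derivatives and primitives. -/

section Primitive

variable {E : Type*} [NormedAddCommGroup E] [NormedSpace ℝ E] {a b : ℝ}

theorem integral_deriv_eq_neg {φ : ℝ → ℝ} (hφ : ContDiff ℝ 1 φ)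
    (hφs : tsupport φ ⊆ Set.Ioo a b) (s : ℝ) :
    ∫ t in s..b, deriv φ t = -φ s := by
  rw [intervalIntegral.integral_deriv_eq_sub' φ rfl
    (fun x _ => hφ.differentiable one_ne_zero x) (hφ.continuous_deriv le_rfl).continuousOn,
    image_eq_zero_of_notMem_tsupport fun h => (hφs h).2.ne rfl, zero_sub]

theorem integral_deriv_smul_const [CompleteSpace E] {φ : ℝ → ℝ} (hab : a < b) (hφ : ContDiff ℝ 1 φ)
    (hφs : tsupport φ ⊆ Set.Ioo a b) (C : E) :
    ∫ t in Set.Ioo a b, deriv φ t • C = 0 := by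
  rw [integral_smul_const, ← integral_Ioc_eq_integral_Ioo, ← intervalIntegral.integral_of_le hab.le,
    integral_deriv_eq_neg hφ hφs,
    image_eq_zero_of_notMem_tsupport fun h => (hφs h).1.ne rfl, neg_zero, zero_smul]

/-- Fubini on the triangle `s ≤ t`: integrating `deriv φ` over `[s,b)` gives `-φ s`, because `φ`
vanishes at `b`. -/
theorem integral_deriv_smul_primitive [CompleteSpace E] {φ : ℝ → ℝ} {v : ℝ → E}
    (hφ : ContDiff ℝ 1 φ) (hφs : tsupport φ ⊆ Set.Ioo a b) (hv : IntegrableOn v (Set.Ioo a b)) :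
    ∫ t in Set.Ioo a b, deriv φ t • ∫ s in a..t, v s = -∫ t in Set.Ioo a b, φ t • v t := by
  have hφ' : Integrable (deriv φ) (volume.restrict (Set.Ioo a b)) :=
    ((hφ.continuous_deriv le_rfl).integrableOn_Icc (a := a) (b := b)).mono_set Set.Ioo_subset_Icc_self
  have hint : Integrable (Function.uncurry fun t s => deriv φ t • (Set.Iic t).indicator v s)
      ((volume.restrict (Set.Ioo a b)).prod (volume.restrict (Set.Ioo a b))) := by
    have h := (hφ'.smul_prod hv).indicator
      (measurableSet_le measurable_snd measurable_fst : MeasurableSet {p : ℝ × ℝ | p.2 ≤ p.1})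
    refine h.congr (ae_of_all _ fun ⟨t, s⟩ => ?_)
    by_cases hst : s ≤ t <;> simp [Set.indicator, hst]
  have h1 : ∀ t ∈ Set.Ioo a b, deriv φ t • ∫ s in a..t, v s =
      ∫ s in Set.Ioo a b, deriv φ t • (Set.Iic t).indicator v s := by
    intro t ht
    rw [integral_smul, setIntegral_indicator measurableSet_Iic,
      intervalIntegral.integral_of_le ht.1.le]
    congr 3
    ext s
    simp only [Set.mem_Ioc, Set.mem_inter_iff, Set.mem_Ioo, Set.mem_Iic]
    exact ⟨fun h => ⟨⟨h.1, h.2.trans_lt ht.2⟩, h.2⟩, fun h => ⟨h.1.1, h.2⟩⟩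
  rw [setIntegral_congr_fun measurableSet_Ioo h1, integral_integral_swap hint, ← integral_neg]
  refine setIntegral_congr_fun measurableSet_Ioo fun s hs => ?_
  have h2 : ∀ t, deriv φ t • (Set.Iic t).indicator v s = (Set.Ici s).indicator (deriv φ) t • v s := by
    intro t
    by_cases hst : s ≤ t <;> simp [Set.indicator, hst]
  simp_rw [h2]
  rw [integral_smul_const, setIntegral_indicator measurableSet_Ici]
  have h3 : Set.Ioo a b ∩ Set.Ici s = Set.Ico s b := by
    ext t
    simp only [Set.mem_Ico, Set.mem_inter_iff, Set.mem_Ioo, Set.mem_Ici]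
    exact ⟨fun h => ⟨h.2, h.1.2⟩, fun h => ⟨⟨hs.1.trans_le h.1, h.2⟩, h.1⟩⟩
  rw [h3, integral_Ico_eq_integral_Ioo, ← integral_Ioc_eq_integral_Ioo,
    ← intervalIntegral.integral_of_le hs.2.le, integral_deriv_eq_neg hφ hφs, neg_smul]

theorem continuousOn_primitive_of_integrableOn {v : ℝ → E} (hab : a < b)
    (hv : IntegrableOn v (Set.Ioo a b)) :
    ContinuousOn (fun t => ∫ s in a..t, v s) (Set.Icc a b) := by
  rw [← Set.uIcc_of_le hab.le]
  refine intervalIntegral.continuousOn_primitive_interval ?_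
  rwa [Set.uIcc_of_le hab.le, integrableOn_Icc_iff_integrableOn_Ioo]

theorem exists_Icc_of_isCompact {S : Set ℝ} (hS : IsCompact S) (hSab : S ⊆ Set.Ioo a b)
    (hab : a < b) : ∃ c d, a < c ∧ d < b ∧ S ⊆ Set.Icc c d := by
  rcases S.eq_empty_or_nonempty with rfl | hne
  · obtain ⟨c, hc⟩ := exists_between hab
    exact ⟨c, c, hc.1, hc.2, Set.empty_subset _⟩
  · exact ⟨sInf S, sSup S, (hSab (hS.sInf_mem hne)).1, (hSab (hS.sSup_mem hne)).2,
      fun x hx => ⟨csInf_le hS.bddBelow hx, le_csSup hS.bddAbove hx⟩⟩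

/-- The vanishing total integral is what makes the primitive zero to the right of the support of
`h`. -/
theorem exists_contDiff_primitive {h : ℝ → ℝ} (hab : a < b) (hh : Continuous h)
    (hcs : HasCompactSupport h) (hs : tsupport h ⊆ Set.Ioo a b) (h0 : ∫ t, h t = 0) :
    ∃ φ : ℝ → ℝ, ContDiff ℝ 1 φ ∧ HasCompactSupport φ ∧ tsupport φ ⊆ Set.Ioo a b ∧ deriv φ = h := by
  obtain ⟨c, d, hc, hd, hcd⟩ := exists_Icc_of_isCompact hcs hs hab
  have hder : ∀ x, HasDerivAt (fun x => ∫ t in a..x, h t) (h x) x := fun x =>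
    (hh.integral_hasStrictDerivAt a x).hasDerivAt
  have hderiv : deriv (fun x => ∫ t in a..x, h t) = h := funext fun x => (hder x).deriv
  have hsupp : Function.support (fun x => ∫ t in a..x, h t) ⊆ Set.Icc c d := by
    intro x hx
    by_contra hxcd
    refine hx ?_
    by_cases hxc : c ≤ x
    · have hdx : d < x := not_le.1 fun h => hxcd ⟨hxc, h⟩
      show ∫ t in a..x, h t = 0
      rw [intervalIntegral.integral_eq_integral_of_support_subset, h0]
      exact fun t ht => ⟨hc.trans_le (hcd (subset_tsupport _ ht)).1,
        (hcd (subset_tsupport _ ht)).2.trans hdx.le⟩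
    · show ∫ t in a..x, h t = 0
      rw [intervalIntegral.integral_congr (g := fun _ => (0 : ℝ)), intervalIntegral.integral_zero]
      intro t ht
      by_contra hne
      have := (hcd (subset_tsupport h hne)).1
      have h2 : t ≤ max a x := ht.2
      exact absurd (this.trans h2) (not_le.2 (max_lt hc (not_le.1 hxc)))
  have hts : tsupport (fun x => ∫ t in a..x, h t) ⊆ Set.Icc c d :=
    closure_minimal hsupp isClosed_Icc
  refine ⟨_, contDiff_one_iff_deriv.2 ⟨fun x => (hder x).differentiableAt, by rwa [hderiv]⟩,
    isCompact_Icc.of_isClosed_subset (isClosed_tsupport _) hts,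
    hts.trans fun x hx => ⟨hc.trans_le hx.1, hx.2.trans_lt hd⟩, hderiv⟩

/-- The du Bois-Reymond lemma. -/
theorem eqOn_const_of_integral_deriv_smul_eq_zero [CompleteSpace E] {D : ℝ → E} (hab : a < b)
    (hD : ContinuousOn D (Set.Icc a b))
    (h : ∀ φ : ℝ → ℝ, ContDiff ℝ 1 φ → HasCompactSupport φ → tsupport φ ⊆ Set.Ioo a b →
      ∫ t in Set.Ioo a b, deriv φ t • D t = 0) :
    ∀ t ∈ Set.Icc a b, D t = D a := by
  -- Subtracting from a test function `g` the multiple `I * e` of a bump `e` of integral 1 leaves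
  -- integral zero, hence the derivative of an admissible test function. The constant must then be
  -- the average `C` of `D` against `e`.
  let η : ContDiffBump ((a + b) / 2) := ⟨(b - a) / 8, (b - a) / 4, by linarith, by linarith⟩
  let e : ℝ → ℝ := η.normed volume
  have he : Continuous e := η.continuous_normed
  have hecs : HasCompactSupport e := η.hasCompactSupport_normed
  have hes : tsupport e ⊆ Set.Ioo a b := by
    rw [show tsupport e = _ from η.tsupport_normed_eq, Real.closedBall_eq_Icc]
    intro x hx
    have h1 := hx.1
    have h2 := hx.2
    simp only [η] at h1 h2
    constructor <;> linarith
  have hDint : ∀ g : ℝ → ℝ, Continuous g → IntegrableOn (fun t => g t • D t) (Set.Ioo a b) :=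
    fun g hg => ((hg.continuousOn.smul hD).integrableOn_Icc).mono_set Set.Ioo_subset_Icc_self
  set C : E := ∫ t in Set.Ioo a b, e t • D t with hC
  have key : ∀ᵐ x, x ∈ Set.Ioo a b → D x - C = 0 := by
    refine isOpen_Ioo.ae_eq_zero_of_integral_contDiff_smul_eq_zero
      (((hD.mono Set.Ioo_subset_Icc_self).sub continuousOn_const).locallyIntegrableOn
        measurableSet_Ioo) fun g hg hgcs hgs => ?_
    have hgc := hg.continuous
    set I : ℝ := ∫ t, g t with hI
    have hsub : tsupport (fun t => g t - I * e t) ⊆ tsupport g ∪ tsupport e := by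
      refine closure_minimal (fun t ht => ?_) ((isClosed_tsupport _).union (isClosed_tsupport _))
      by_contra hcon
      rw [Set.mem_union, not_or] at hcon
      exact ht (by simp [image_eq_zero_of_notMem_tsupport hcon.1,
        image_eq_zero_of_notMem_tsupport hcon.2])
    obtain ⟨φ, hφ, hφcs, hφs, hφd⟩ := exists_contDiff_primitive hab
      (hgc.sub (he.const_smul I))
      ((hgcs.isCompact.union hecs.isCompact).of_isClosed_subset (isClosed_tsupport _) hsub)
      (hsub.trans (Set.union_subset hgs hes)) (by
        show ∫ t, (g t - I * e t) = 0
        rw [integral_sub (hgc.integrable_of_hasCompactSupport hgcs)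
          ((he.integrable_of_hasCompactSupport hecs).const_mul I), integral_const_mul,
          show ∫ t, e t = 1 from η.integral_normed, mul_one, sub_self])
    have h0 := h φ hφ hφcs hφs
    rw [hφd] at h0
    have h1 : ∫ t in Set.Ioo a b, g t • D t = I • C := by
      have hs := (hDint e he).smul I
      rw [← sub_eq_zero, hC, ← integral_smul, ← integral_sub (hDint g hgc) (by exact hs), ← h0]
      refine integral_congr_ae (ae_of_all _ fun t => ?_)
      simp only [Pi.sub_apply, Pi.smul_apply, smul_eq_mul]
      rw [sub_smul, mul_smul]
    have h2 : ∫ t in Set.Ioo a b, g t = I := setIntegral_eq_integral_of_forall_compl_eq_zero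
      fun t ht => image_eq_zero_of_notMem_tsupport fun h => ht (hgs h)
    rw [← setIntegral_eq_integral_of_forall_compl_eq_zero (s := Set.Ioo a b) fun t ht => by
      rw [image_eq_zero_of_notMem_tsupport fun h => ht (hgs h), zero_smul]]
    simp_rw [smul_sub]
    rw [integral_sub (hDint g hgc), h1, integral_smul_const, h2, sub_self]
    exact ((hgc.integrable_of_hasCompactSupport hgcs).smul_const C).integrableOn
  have hEq : Set.EqOn D (fun _ => C) (Set.Icc a b) := by
    refine Measure.eqOn_Icc_of_ae_eq volume hab.ne ?_ hD continuousOn_const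
    rw [← restrict_Ioo_eq_restrict_Icc, EventuallyEq, ae_restrict_iff' measurableSet_Ioo]
    filter_upwards [key] with x hx hxab
    exact sub_eq_zero.1 (hx hxab)
  intro t ht
  rw [hEq ht, hEq (Set.left_mem_Icc.2 hab.le)]

theorem eq_add_primitive [CompleteSpace E] {σ v : ℝ → E} (hab : a < b)
    (hσ : ContinuousOn σ (Set.Icc a b)) (hv : IntegrableOn v (Set.Ioo a b))
    (h : ∀ φ : ℝ → ℝ, ContDiff ℝ 1 φ → HasCompactSupport φ → tsupport φ ⊆ Set.Ioo a b →
      ∫ t in Set.Ioo a b, deriv φ t • σ t = -∫ t in Set.Ioo a b, φ t • v t) :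
    ∀ t ∈ Set.Icc a b, σ t = σ a + ∫ s in a..t, v s := by
  have hp := continuousOn_primitive_of_integrableOn hab hv
  have key := eqOn_const_of_integral_deriv_smul_eq_zero hab (hσ.sub hp) fun φ hφ hφc hφs => by
    have hi : ∀ τ : ℝ → E, ContinuousOn τ (Set.Icc a b) →
        IntegrableOn (fun t => deriv φ t • τ t) (Set.Ioo a b) := fun τ hτ =>
      (((hφ.continuous_deriv le_rfl).continuousOn.smul hτ).integrableOn_Icc).mono_set
        Set.Ioo_subset_Icc_self
    simp only [Pi.sub_apply, smul_sub]
    rw [integral_sub (hi _ hσ) (hi _ hp), h φ hφ hφc hφs,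
      integral_deriv_smul_primitive hφ hφs hv, sub_self]
  intro t ht
  have := key t ht
  simp only [Pi.sub_apply, intervalIntegral.integral_same, sub_zero] at this
  rw [← this, sub_add_cancel]

end Primitive

section WeakDerivative

variable {a b : ℝ} {σ v : ℝ → L2I}

theorem HasWeakDerivOn.of_primitive (hab : a < b) (hv : IntegrableOn v (Set.Ioo a b))
    (h : ∀ t ∈ Set.Icc a b, σ t = σ a + ∫ s in a..t, v s) : HasWeakDerivOn (Set.Icc a b) σ v := by
  have hp := continuousOn_primitive_of_integrableOn hab hv
  refine ⟨(continuousOn_const.add hp).congr h,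
    ((integrableOn_Icc_iff_integrableOn_Ioo (by simp) (by simp)).2 hv).locallyIntegrableOn,
    fun φ hφ _ hφs => ?_⟩
  rw [interior_Icc] at hφs
  rw [integral_Icc_eq_integral_Ioo, integral_Icc_eq_integral_Ioo]
  have h1 : ∀ t ∈ Set.Ioo a b, deriv φ t • σ t = deriv φ t • σ a + deriv φ t • ∫ s in a..t, v s :=
    fun t ht => by rw [← smul_add, ← h t (Set.Ioo_subset_Icc_self ht)]
  have hi : ∀ τ : ℝ → L2I, ContinuousOn τ (Set.Icc a b) →
      IntegrableOn (fun t => deriv φ t • τ t) (Set.Ioo a b) := fun τ hτ =>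
    (((hφ.continuous_deriv le_rfl).continuousOn.smul hτ).integrableOn_Icc).mono_set
      Set.Ioo_subset_Icc_self
  rw [setIntegral_congr_fun measurableSet_Ioo h1, integral_add (hi _ continuousOn_const) (hi _ hp),
    integral_deriv_smul_const hab hφ hφs, zero_add, integral_deriv_smul_primitive hφ hφs hv]

theorem HasWeakDerivOn.integrableOn (h : HasWeakDerivOn (Set.Icc a b) σ v) :
    IntegrableOn v (Set.Ioo a b) :=
  (h.locallyIntegrableOn.integrableOn_isCompact isCompact_Icc).mono_set Set.Ioo_subset_Icc_self

theorem HasWeakDerivOn.eq_add_integral (hab : a < b) (h : HasWeakDerivOn (Set.Icc a b) σ v) :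
    ∀ t ∈ Set.Icc a b, σ t = σ a + ∫ s in a..t, v s := by
  refine eq_add_primitive hab h.continuousOn h.integrableOn fun φ hφ hφc hφs => ?_
  have := h.integral_eq φ hφ hφc (by rwa [interior_Icc])
  rwa [integral_Icc_eq_integral_Ioo, integral_Icc_eq_integral_Ioo] at this

theorem HasWeakDerivOn.eq_add_integral_of_Ioo (hab : a < b) (h : HasWeakDerivOn (Set.Ioo a b) σ v)
    (hσ : ContinuousOn σ (Set.Icc a b)) (hv : IntegrableOn v (Set.Ioo a b)) :
    ∀ t ∈ Set.Icc a b, σ t = σ a + ∫ s in a..t, v s :=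
  eq_add_primitive hab hσ hv fun φ hφ hφc hφs => h.integral_eq φ hφ hφc (by rwa [interior_Ioo])

theorem HasWeakDerivOn.ae_eq {v' : ℝ → L2I} (h : HasWeakDerivOn (Set.Icc a b) σ v)
    (h' : HasWeakDerivOn (Set.Icc a b) σ v') : v =ᵐ[volume.restrict (Set.Ioo a b)] v' := by
  have key : ∀ᵐ x, x ∈ Set.Ioo a b → v x - v' x = 0 := by
    refine isOpen_Ioo.ae_eq_zero_of_integral_contDiff_smul_eq_zero
      (h.integrableOn.sub h'.integrableOn).locallyIntegrableOn fun g hg hgcs hgs => ?_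
    have hi : ∀ w : ℝ → L2I, IntegrableOn w (Set.Ioo a b) →
        IntegrableOn (fun t => g t • w t) (Set.Ioo a b) := fun w hw => by
      obtain ⟨C, hC⟩ := hgcs.exists_bound_of_continuous hg.continuous
      exact hw.bdd_smul C hg.continuous.aestronglyMeasurable (ae_of_all _ hC)
    have e : ∫ t in Set.Ioo a b, g t • v t = ∫ t in Set.Ioo a b, g t • v' t := by
      have h1 := h.integral_eq g (hg.of_le (by norm_num)) hgcs (by rwa [interior_Icc])
      have h2 := h'.integral_eq g (hg.of_le (by norm_num)) hgcs (by rwa [interior_Icc])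
      rw [h1, neg_inj, integral_Icc_eq_integral_Ioo, integral_Icc_eq_integral_Ioo] at h2
      exact h2
    rw [← setIntegral_eq_integral_of_forall_compl_eq_zero (s := Set.Ioo a b) fun t ht => by
      rw [image_eq_zero_of_notMem_tsupport fun h => ht (hgs h), zero_smul]]
    simp_rw [smul_sub]
    rw [integral_sub (hi v h.integrableOn) (hi v' h'.integrableOn), e, sub_self]
  rw [EventuallyEq, ae_restrict_iff' measurableSet_Ioo]
  filter_upwards [key] with x hx hxab
  exact sub_eq_zero.1 (hx hxab)

end WeakDerivative

/-! ### The action: finiteness, coercivity, and its value for square integrable velocities. -/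

theorem coe_ennreal_eq_coe_toReal {x : ENNReal} (hx : x ≠ ⊤) :
    (x : EReal) = ((x.toReal : ℝ) : EReal) := by
  lift x to NNReal using hx
  rfl

theorem extIntegral_eq_coe {a b : ℝ} {f : ℝ → ℝ} (hf : IntegrableOn f (Set.Ioo a b)) :
    extIntegral a b f = ((∫ t in Set.Ioo a b, f t : ℝ) : EReal) := by
  have hneg : ∫⁻ t in Set.Ioo a b, ENNReal.ofReal (-f t) ≠ ⊤ := hf.neg.lintegral_lt_top.ne
  rw [extIntegral, coe_ennreal_eq_coe_toReal hf.lintegral_lt_top.ne,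
    coe_ennreal_eq_coe_toReal hneg, ← EReal.coe_sub,
    integral_eq_lintegral_pos_part_sub_lintegral_neg_part hf]

/-- On a bounded interval the lower bound makes the negative part finite, so failure of
integrability can only come from the positive part. -/
theorem extIntegral_eq_top {a b B : ℝ} {f : ℝ → ℝ}
    (hm : AEStronglyMeasurable f (volume.restrict (Set.Ioo a b)))
    (hf : ¬ IntegrableOn f (Set.Ioo a b)) (hB : ∀ t, B ≤ f t) : extIntegral a b f = ⊤ := by
  have hneg : ∫⁻ t in Set.Ioo a b, ENNReal.ofReal (-f t) ≠ ⊤ := by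
    refine ne_top_of_le_ne_top ?_ (lintegral_mono fun t =>
      ENNReal.ofReal_le_ofReal (neg_le_neg (hB t)))
    rw [lintegral_const]
    exact ENNReal.mul_ne_top ENNReal.ofReal_ne_top (measure_ne_top _ _)
  have hpos : ∫⁻ t in Set.Ioo a b, ENNReal.ofReal (f t) = ⊤ := by
    by_contra h
    refine hf ⟨hm, lt_of_le_of_lt ?_ (ENNReal.add_lt_top.2
      ⟨lt_top_iff_ne_top.2 h, lt_top_iff_ne_top.2 hneg⟩)⟩
    rw [← lintegral_add_left' hm.aemeasurable.ennreal_ofReal]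
    refine lintegral_mono fun t => ?_
    rw [Real.enorm_eq_ofReal_abs]
    rcases abs_cases (f t) with ⟨h1, -⟩ | ⟨h1, -⟩ <;> rw [h1]
    · exact le_self_add
    · exact le_add_self
  rw [extIntegral, hpos, coe_ennreal_eq_coe_toReal hneg, EReal.coe_ennreal_top, EReal.top_sub_coe]

section Action

variable {V : ℝ → ℝ → ℝ} {W : ℝ → ℝ} {a b c : ℝ} {σ v : ℝ → L2I}

theorem IsPotentialPair.continuousOn_potential (h : IsPotentialPair V W) {s : Set ℝ}
    (hσ : ContinuousOn σ s) : ContinuousOn (fun t => potential V W t (σ t)) s := by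
  obtain ⟨K, hK0, hK⟩ := h.exists_potential_lipschitz
  intro t ht
  have h1 : Tendsto (fun u => K * (|u - t| + ‖σ u - σ t‖)) (𝓝[s] t) (𝓝 0) := by
    have h2 : Tendsto (fun u => |u - t|) (𝓝[s] t) (𝓝 0) := by
      have : Continuous fun u : ℝ => |u - t| := by fun_prop
      simpa using (this.tendsto t).mono_left nhdsWithin_le_nhds
    have h3 := tendsto_iff_norm_sub_tendsto_zero.1 (hσ t ht)
    simpa using (h2.add h3).const_mul K
  exact tendsto_iff_norm_sub_tendsto_zero.2
    (squeeze_zero (fun _ => norm_nonneg _) (fun u => hK u t _ _) h1)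

theorem IsPotentialPair.integrableOn_potential (h : IsPotentialPair V W)
    (hσ : ContinuousOn σ (Set.Ioo a b)) :
    IntegrableOn (fun t => potential V W t (σ t)) (Set.Ioo a b) := by
  obtain ⟨B, -, hB⟩ := h.exists_potential_bound
  exact Integrable.of_bound ((h.continuousOn_potential hσ).aestronglyMeasurable measurableSet_Ioo) B
    (ae_of_all _ fun t => hB _ _)

theorem integrable_mean {v : ℝ → L2I} {μ : Measure ℝ} (hv : Integrable v μ) :
    Integrable (fun t => mean (v t)) μ := mean.integrable_comp hv

theorem IsPotentialPair.integrableOn_lagrangianC (h : IsPotentialPair V W) (c : ℝ)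
    (hσ : ContinuousOn σ (Set.Ioo a b)) (hv : MemLp v 2 (volume.restrict (Set.Ioo a b))) :
    IntegrableOn (fun t => lagrangianC V W c t (σ t) (v t)) (Set.Ioo a b) := by
  simp_rw [lagrangianC_eq]
  exact ((hv.norm.integrable_sq.const_mul _).sub (h.integrableOn_potential hσ)).sub
    ((integrable_mean (hv.integrable (by norm_num))).const_mul _)

theorem IsPotentialPair.action_eq_coe (h : IsPotentialPair V W) (c : ℝ)
    (hσ : ContinuousOn σ (Set.Ioo a b)) (hv : MemLp v 2 (volume.restrict (Set.Ioo a b))) :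
    action V W c a b σ v = ((∫ t in Set.Ioo a b, lagrangianC V W c t (σ t) (v t) : ℝ) : EReal) :=
  extIntegral_eq_coe (h.integrableOn_lagrangianC c hσ hv)

/-- Young's inequality `|c| ‖N‖ ≤ c² + ‖N‖²/4` absorbs the linear term into half of the kinetic
energy. -/
theorem IsPotentialPair.exists_norm_sq_le (h : IsPotentialPair V W) (c : ℝ) :
    ∃ B, 0 ≤ B ∧ ∀ t M N, (1 / 4) * ‖N‖ ^ 2 - B ≤ lagrangianC V W c t M N := by
  obtain ⟨B, hB0, hB⟩ := h.exists_potential_bound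
  refine ⟨B + c ^ 2, by positivity, fun t M N => ?_⟩
  rw [lagrangianC_eq]
  have h1 := (abs_le.1 (hB t M)).2
  have h2 : c * mean N ≤ c ^ 2 + (1 / 4) * ‖N‖ ^ 2 := by
    have h3 : c * mean N ≤ |c| * ‖N‖ := by
      refine (le_abs_self _).trans ?_
      rw [abs_mul]
      exact mul_le_mul_of_nonneg_left (abs_mean_le N) (abs_nonneg c)
    nlinarith [sq_nonneg (|c| - ‖N‖ / 2), sq_abs c]
  linarith

/-- By coercivity the Lagrangian dominates the squared speed up to constants. Competitors with
velocity outside `L²` therefore have infinite action and may be ignored. -/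
theorem IsPotentialPair.memLp_of_action_ne_top (h : IsPotentialPair V W)
    (hσ : ContinuousOn σ (Set.Ioo a b)) (hv : LocallyIntegrableOn v (Set.Ioo a b))
    (hA : action V W c a b σ v ≠ ⊤) : MemLp v 2 (volume.restrict (Set.Ioo a b)) := by
  obtain ⟨B, hB0, hB⟩ := h.exists_norm_sq_le c
  have hvm := hv.aestronglyMeasurable
  have hm : AEStronglyMeasurable (fun t => lagrangianC V W c t (σ t) (v t))
      (volume.restrict (Set.Ioo a b)) := by
    simp_rw [lagrangianC_eq]
    exact (((hvm.norm.pow 2).const_mul _).sub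
      (h.integrableOn_potential hσ).aestronglyMeasurable).sub
      ((mean.continuous.comp_aestronglyMeasurable hvm).const_mul c)
  have hint : IntegrableOn (fun t => lagrangianC V W c t (σ t) (v t)) (Set.Ioo a b) := by
    by_contra hcon
    exact hA (extIntegral_eq_top (B := -B) hm hcon fun t => by
      have := hB t (σ t) (v t)
      have := sq_nonneg ‖v t‖
      linarith)
  rw [← memLp_norm_iff hvm, memLp_two_iff_integrable_sq hvm.norm]
  refine Integrable.mono' ((hint.add (integrable_const B)).const_mul 4) (hvm.norm.pow 2)
    (ae_of_all _ fun t => ?_)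
  have := hB t (σ t) (v t)
  rw [Real.norm_eq_abs, abs_of_nonneg (sq_nonneg _)]
  simp only [Pi.add_apply]
  linarith

/-- The term with `c` is exact and depends only on the means of the end points; this is why a
rearrangement need only preserve the mean. -/
theorem IsPotentialPair.integral_lagrangianC (h : IsPotentialPair V W) (c : ℝ) (hab : a < b)
    (hσ : ContinuousOn σ (Set.Icc a b)) (hv : MemLp v 2 (volume.restrict (Set.Ioo a b)))
    (hσv : σ b = σ a + ∫ s in a..b, v s) :
    ∫ t in Set.Ioo a b, lagrangianC V W c t (σ t) (v t) =
      (1 / 2) * (∫ t in Set.Ioo a b, ‖v t‖ ^ 2) - (∫ t in Set.Ioo a b, potential V W t (σ t)) -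
        c * (mean (σ b) - mean (σ a)) := by
  have hvi : Integrable v (volume.restrict (Set.Ioo a b)) := hv.integrable (by norm_num)
  have hp := h.integrableOn_potential (hσ.mono Set.Ioo_subset_Icc_self)
  have h2 := hv.norm.integrable_sq.const_mul (1 / 2)
  simp_rw [lagrangianC_eq]
  rw [integral_sub (f := fun t => 1 / 2 * ‖v t‖ ^ 2 - potential V W t (σ t)) (h2.sub hp)
    ((integrable_mean hvi).const_mul c), integral_sub h2 hp,
    integral_const_mul, integral_const_mul, mean.integral_comp_comm hvi, hσv, map_add,
    intervalIntegral.integral_of_le hab.le, integral_Ioc_eq_integral_Ioo, add_sub_cancel_left]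

end Action

/-! ### Kinetic energy measured by increments on grids. -/

theorem sum_range_mul {A : Type*} [AddCommMonoid A] (f : ℕ → A) (N K : ℕ) :
    ∑ j ∈ Finset.range (N * K), f j =
      ∑ i ∈ Finset.range N, ∑ r ∈ Finset.range K, f (i * K + r) := by
  induction N with
  | zero => simp
  | succ N ih => rw [Nat.succ_mul, Finset.sum_range_add, ih, Finset.sum_range_succ]

theorem integral_comp_floor (N : ℕ) [NeZero N] (f : ℕ → ℝ) :
    ∫ t in Set.Ioo (0 : ℝ) 1, f ⌊N * t⌋₊ = (N : ℝ)⁻¹ * ∑ i ∈ Finset.range N, f i := by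
  rw [← integral_Ico_eq_integral_Ioo, ← integral_subtype_comap measurableSet_Ico,
    ← Fin.sum_univ_eq_sum_range, ← integral_comp_cellIndex]
  rfl

section DyadicVelocity

variable {E : Type*} [NormedAddCommGroup E]

/-- The increment of a curve over the `i`-th of `N` intervals of equal length. -/
def increment (γ : ℝ → E) (N i : ℕ) : E := γ ((i + 1 : ℕ) / N) - γ (i / N)

theorem sum_increment (γ : ℝ → E) (N K i : ℕ) [NeZero K] :
    ∑ r ∈ Finset.range K, increment γ (N * K) (i * K + r) = increment γ N i := by
  have h := Finset.sum_range_sub (fun r : ℕ => γ ((i * K + r : ℕ) / (N * K : ℕ))) K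
  have hK : (K : ℝ) ≠ 0 := by exact_mod_cast NeZero.ne K
  simp only [increment]
  simp only [← add_assoc] at h ⊢
  rw [h]
  congr 2
  · push_cast
    rw [← mul_div_mul_right ((i : ℝ) + 1) (N : ℝ) hK]
    ring_nf
  · push_cast
    rw [← mul_div_mul_right (i : ℝ) (N : ℝ) hK]
    ring_nf

variable [InnerProductSpace ℝ E]

/-- The velocity of the piecewise linear interpolation of a curve at the multiples of `1/N`. -/
def gridVelocity (γ : ℝ → E) (N : ℕ) (t : ℝ) : E := (N : ℝ) • increment γ N ⌊N * t⌋₊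

theorem memLp_gridVelocity (γ : ℝ → E) (N : ℕ) [NeZero N] :
    MemLp (gridVelocity γ N) 2 (volume.restrict (Set.Ioo (0 : ℝ) 1)) := by
  have hm : Measurable fun t : ℝ => ⌊N * t⌋₊ := Nat.measurable_floor.comp (measurable_id.const_mul _)
  have hs : StronglyMeasurable (gridVelocity γ N) :=
    (StronglyMeasurable.of_discrete (f := fun i => (N : ℝ) • increment γ N i)).comp_measurable hm
  refine MemLp.of_bound hs.aestronglyMeasurable
    (∑ i ∈ Finset.range N, ‖(N : ℝ) • increment γ N i‖) ?_
  rw [ae_restrict_iff' measurableSet_Ioo]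
  refine ae_of_all _ fun t ht => ?_
  refine Finset.single_le_sum (f := fun i => ‖(N : ℝ) • increment γ N i‖)
    (fun _ _ => norm_nonneg _) (Finset.mem_range.2 ?_)
  have hN := cast_pos_of_neZero N
  rw [Nat.floor_lt (mul_nonneg hN.le ht.1.le)]
  nlinarith [ht.2]

/-- The kinetic energy of the piecewise linear interpolation. -/
def gridEnergy (γ : ℝ → E) (N : ℕ) : ℝ := ∑ i ∈ Finset.range N, N * ‖increment γ N i‖ ^ 2

/-- Pythagoras: on each coarse interval the coarse velocity is the average of the fine one, hence
its orthogonal projection in `L²`. -/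
theorem integral_norm_gridVelocity_sub_sq (γ : ℝ → E) (N K : ℕ) [NeZero N] [NeZero K] :
    ∫ t in Set.Ioo (0 : ℝ) 1, ‖gridVelocity γ (N * K) t - gridVelocity γ N t‖ ^ 2 =
      gridEnergy γ (N * K) - gridEnergy γ N := by
  have hN := cast_pos_of_neZero N
  have hK := cast_pos_of_neZero K
  have hNK : NeZero (N * K) := ⟨mul_ne_zero (NeZero.ne N) (NeZero.ne K)⟩
  have h1 : ∀ t : ℝ, ⌊N * t⌋₊ = ⌊(N * K : ℕ) * t⌋₊ / K := fun t => by
    rw [← Nat.floor_div_natCast]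
    congr 1
    push_cast
    field_simp
  have h2 := integral_comp_floor (N * K) fun j =>
    ‖((N * K : ℕ) : ℝ) • increment γ (N * K) j - (N : ℝ) • increment γ N (j / K)‖ ^ 2
  simp only [gridVelocity]
  simp_rw [h1]
  rw [h2, sum_range_mul, Finset.mul_sum, gridEnergy, gridEnergy, sum_range_mul,
    ← Finset.sum_sub_distrib]
  refine Finset.sum_congr rfl fun i _ => ?_
  have h3 : ∀ r ∈ Finset.range K, (i * K + r) / K = i := fun r hr => by
    rw [mul_comm, Nat.mul_add_div (Nat.pos_of_ne_zero (NeZero.ne K)),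
      Nat.div_eq_of_lt (Finset.mem_range.1 hr), add_zero]
  have h4 : ∑ r ∈ Finset.range K, ‖((N * K : ℕ) : ℝ) • increment γ (N * K) (i * K + r) -
      (N : ℝ) • increment γ N ((i * K + r) / K)‖ ^ 2 =
      ∑ r ∈ Finset.range K, (((N * K : ℕ) : ℝ) ^ 2 * ‖increment γ (N * K) (i * K + r)‖ ^ 2 -
        2 * ((N * K : ℕ) : ℝ) * N * inner ℝ (increment γ (N * K) (i * K + r)) (increment γ N i) +
        (N : ℝ) ^ 2 * ‖increment γ N i‖ ^ 2) := by
    refine Finset.sum_congr rfl fun r hr => ?_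
    rw [h3 r hr, norm_sub_sq_real, norm_smul, norm_smul, inner_smul_left, inner_smul_right,
      Real.norm_natCast, Real.norm_natCast]
    simp
    ring
  rw [h4, Finset.sum_add_distrib, Finset.sum_sub_distrib, ← Finset.mul_sum, ← Finset.mul_sum,
    ← sum_inner, sum_increment, real_inner_self_eq_norm_sq, ← Finset.mul_sum, Finset.sum_const,
    Finset.card_range, nsmul_eq_mul, ← Finset.mul_sum]
  generalize ∑ r ∈ Finset.range K, ‖increment γ (N * K) (i * K + r)‖ ^ 2 = S
  push_cast
  field_simp
  ring

theorem integral_norm_gridVelocity_sq (γ : ℝ → E) (N : ℕ) [NeZero N] :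
    ∫ t in Set.Ioo (0 : ℝ) 1, ‖gridVelocity γ N t‖ ^ 2 = gridEnergy γ N := by
  have hN := cast_pos_of_neZero N
  have h := integral_comp_floor N fun j => ‖(N : ℝ) • increment γ N j‖ ^ 2
  simp only [gridVelocity]
  rw [h, gridEnergy, Finset.mul_sum]
  refine Finset.sum_congr rfl fun i _ => ?_
  rw [norm_smul, Real.norm_natCast]
  field_simp

theorem integral_gridVelocity (γ : ℝ → E) [CompleteSpace E] (N : ℕ) [NeZero N] (j : ℕ) :
    ∫ t in (0 : ℝ)..(j / N), gridVelocity γ N t = γ (j / N) - γ 0 := by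
  have hN := cast_pos_of_neZero N
  have hcell : ∀ i : ℕ, Set.EqOn (gridVelocity γ N) (fun _ => (N : ℝ) • increment γ N i)
      (Set.Ioo ((i : ℝ) / N) ((i + 1 : ℕ) / N)) := by
    intro i t ht
    have h1 := (div_lt_iff₀ hN).1 ht.1
    have h2 := (lt_div_iff₀ hN).1 ht.2
    push_cast at h2
    have : ⌊N * t⌋₊ = i := by
      rw [Nat.floor_eq_iff (by nlinarith [Nat.cast_nonneg (α := ℝ) i])]
      constructor <;> linarith
    simp only [gridVelocity, this]
  have hle : ∀ i : ℕ, (i : ℝ) / N ≤ (i + 1 : ℕ) / N := fun i => by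
    push_cast
    gcongr
    linarith
  have hint : ∀ i : ℕ, IntervalIntegrable (gridVelocity γ N) volume (i / N) ((i + 1 : ℕ) / N) := by
    intro i
    rw [intervalIntegrable_iff_integrableOn_Ioo_of_le (hle i)]
    exact (integrableOn_const (by simp) (by simp)).congr_fun (hcell i).symm measurableSet_Ioo
  have hval : ∀ i : ℕ, ∫ t in (i : ℝ) / N..(i + 1 : ℕ) / N, gridVelocity γ N t =
      increment γ N i := by
    intro i
    rw [intervalIntegral.integral_of_le (hle i), integral_Ioc_eq_integral_Ioo,
      setIntegral_congr_fun measurableSet_Ioo (hcell i), setIntegral_const, smul_smul,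
      Real.volume_real_Ioo_of_le (hle i)]
    have : (((i + 1 : ℕ) : ℝ) / N - i / N) * N = 1 := by
      push_cast
      field_simp
      ring
    rw [this, one_smul]
  have hsum := intervalIntegral.sum_integral_adjacent_intervals (f := gridVelocity γ N)
    (μ := volume) (a := fun i : ℕ => (i : ℝ) / N) (n := j) fun i _ => hint i
  rw [Nat.cast_zero, zero_div] at hsum
  rw [← hsum, Finset.sum_congr rfl fun i _ => hval i]
  have := Finset.sum_range_sub (fun i : ℕ => γ ((i : ℝ) / N)) j
  rwa [Nat.cast_zero, zero_div] at this

theorem norm_toLp_sq {μ : Measure ℝ} {f : ℝ → E} (hf : MemLp f 2 μ) :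
    ‖hf.toLp f‖ ^ 2 = ∫ t, ‖f t‖ ^ 2 ∂μ := by
  rw [← real_inner_self_eq_norm_sq, L2.inner_def]
  refine integral_congr_ae ?_
  filter_upwards [hf.coeFn_toLp] with t ht
  rw [ht, real_inner_self_eq_norm_sq]

theorem norm_integral_sub_le {f g : ℝ → E}
    (hf : MemLp f 2 (volume.restrict (Set.Ioo (0 : ℝ) 1)))
    (hg : MemLp g 2 (volume.restrict (Set.Ioo (0 : ℝ) 1))) {s : ℝ} (hs : s ∈ Set.Icc (0 : ℝ) 1) :
    ‖(∫ t in (0 : ℝ)..s, f t) - ∫ t in (0 : ℝ)..s, g t‖ ≤ ‖hf.toLp f - hg.toLp g‖ := by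
  have hsub : Set.Ioo 0 s ⊆ Set.Ioo (0 : ℝ) 1 := Set.Ioo_subset_Ioo_right hs.2
  have hfg := hf.sub hg
  have hi : ∀ {k : ℝ → E}, MemLp k 2 (volume.restrict (Set.Ioo (0 : ℝ) 1)) →
      IntegrableOn k (Set.Ioo 0 s) := fun {k} hk => by
    have h : Integrable k (volume.restrict (Set.Ioo (0 : ℝ) 1)) := hk.integrable (by norm_num)
    exact IntegrableOn.mono_set h hsub
  rw [intervalIntegral.integral_of_le hs.1, intervalIntegral.integral_of_le hs.1,
    integral_Ioc_eq_integral_Ioo, integral_Ioc_eq_integral_Ioo, ← integral_sub (hi hf) (hi hg),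
    ← MemLp.toLp_sub]
  calc ‖∫ t in Set.Ioo 0 s, (f t - g t)‖ ≤ ∫ t in Set.Ioo 0 s, ‖f t - g t‖ :=
        norm_integral_le_integral_norm _
    _ ≤ ∫ t in Set.Ioo 0 1, ‖f t - g t‖ :=
        setIntegral_mono_set (hfg.integrable (by norm_num)).norm
          (ae_of_all _ fun _ => norm_nonneg _) hsub.eventuallyLE
    _ ≤ ‖hfg.toLp (f - g)‖ := by
        refine (abs_le_of_sq_le_sq' ?_ (norm_nonneg _)).2
        rw [norm_toLp_sq]
        simpa using sq_integral_le hfg.norm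

/-- A continuous curve whose piecewise linear interpolations have bounded kinetic energy has a
square integrable velocity. -/
theorem exists_velocity_of_gridEnergy_le [CompleteSpace E] {γ : ℝ → E}
    (hγ : ContinuousOn γ (Set.Icc 0 1)) {A : ℝ} (hA : ∀ m : ℕ, gridEnergy γ (2 ^ m) ≤ A) :
    ∃ v : ℝ → E, MemLp v 2 (volume.restrict (Set.Ioo (0 : ℝ) 1)) ∧
      ∫ t in Set.Ioo (0 : ℝ) 1, ‖v t‖ ^ 2 ≤ A ∧
      ∀ t ∈ Set.Icc (0 : ℝ) 1, γ t = γ 0 + ∫ s in (0 : ℝ)..t, v s := by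
  have hmem : ∀ m : ℕ, MemLp (gridVelocity γ (2 ^ m)) 2 (volume.restrict (Set.Ioo (0 : ℝ) 1)) :=
    fun m => memLp_gridVelocity γ (2 ^ m)
  let u : ℕ → Lp E 2 (volume.restrict (Set.Ioo (0 : ℝ) 1)) := fun m => (hmem m).toLp _
  -- Squared distances are differences of energies, which increase with `m` and stay below `A`; so
  -- the velocities form a Cauchy sequence.
  have hdist : ∀ m k, ‖u (m + k) - u m‖ ^ 2 = gridEnergy γ (2 ^ (m + k)) - gridEnergy γ (2 ^ m) := by
    intro m k
    have h := integral_norm_gridVelocity_sub_sq γ (2 ^ m) (2 ^ k)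
    rw [← pow_add] at h
    rw [← h, ← MemLp.toLp_sub, norm_toLp_sq]
    rfl
  have hmono : Monotone fun m => gridEnergy γ (2 ^ m) := monotone_nat_of_le_succ fun m => by
    have := hdist m 1
    nlinarith [sq_nonneg ‖u (m + 1) - u m‖]
  have hlim := tendsto_atTop_ciSup hmono ⟨A, by rintro _ ⟨m, rfl⟩; exact hA m⟩
  have hcauchy : CauchySeq u := by
    rw [Metric.cauchySeq_iff']
    intro ε hε
    obtain ⟨m, hm⟩ := Metric.cauchySeq_iff'.1 hlim.cauchySeq (ε ^ 2) (by positivity)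
    refine ⟨m, fun n hn => ?_⟩
    obtain ⟨k, rfl⟩ := Nat.exists_eq_add_of_le hn
    rw [dist_eq_norm]
    refine lt_of_pow_lt_pow_left₀ 2 hε.le ?_
    rw [hdist]
    exact (le_abs_self _).trans_lt (hm _ hn)
  obtain ⟨v, hv⟩ := cauchySeq_tendsto_of_complete hcauchy
  have hvL : MemLp (v : ℝ → E) 2 (volume.restrict (Set.Ioo (0 : ℝ) 1)) := Lp.memLp v
  have hvt : hvL.toLp v = v := Lp.toLp_coeFn v _
  refine ⟨v, hvL, ?_, fun t ht => ?_⟩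
  · rw [← norm_toLp_sq hvL, hvt]
    refine le_of_tendsto (hv.norm.pow 2) (Eventually.of_forall fun m => ?_)
    rw [norm_toLp_sq, integral_norm_gridVelocity_sq]
    exact hA m
  -- `s m` is the last dyadic point of level `m` not after `t`. At grid points the primitive of the
  -- grid velocity agrees exactly with the increment of `γ` from 0.
  · let s : ℕ → ℝ := fun m => ⌊(2 ^ m : ℕ) * t⌋₊ / (2 ^ m : ℕ)
    have hpos : ∀ m : ℕ, (0 : ℝ) < (2 ^ m : ℕ) := fun m => by positivity
    have hst : ∀ m, s m ≤ t := fun m => by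
      rw [div_le_iff₀ (hpos m), mul_comm t]
      exact Nat.floor_le (mul_nonneg (hpos m).le ht.1)
    have hsI : ∀ m, s m ∈ Set.Icc (0 : ℝ) 1 := fun m =>
      ⟨by positivity, (hst m).trans ht.2⟩
    have hslim : Tendsto s atTop (𝓝 t) := by
      have h1 : Tendsto (fun m : ℕ => t - (1 / 2 : ℝ) ^ m) atTop (𝓝 t) := by
        simpa using (tendsto_pow_atTop_nhds_zero_of_lt_one (r := (1 / 2 : ℝ)) (by norm_num)
          (by norm_num)).const_sub t
      refine tendsto_of_tendsto_of_tendsto_of_le_of_le h1 tendsto_const_nhds (fun m => ?_) hst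
      have h2 := Nat.lt_floor_add_one ((2 ^ m : ℕ) * t)
      have h3 : (1 / 2 : ℝ) ^ m * (2 ^ m : ℕ) = 1 := by
        push_cast
        rw [← mul_pow]
        norm_num
      show t - (1 / 2 : ℝ) ^ m ≤ _ / _
      rw [le_div_iff₀ (hpos m), sub_mul, h3]
      linarith
    have hsw : Tendsto s atTop (𝓝[Set.Icc 0 1] t) :=
      tendsto_nhdsWithin_iff.2 ⟨hslim, Eventually.of_forall hsI⟩
    have hγlim : Tendsto (fun m => γ (s m) - γ 0) atTop (𝓝 (γ t - γ 0)) :=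
      ((hγ t ht).tendsto.comp hsw).sub_const _
    have hvi : IntegrableOn (v : ℝ → E) (Set.Ioo (0 : ℝ) 1) := hvL.integrable (by norm_num)
    have hplim : Tendsto (fun m => ∫ r in (0 : ℝ)..s m, v r) atTop (𝓝 (∫ r in (0 : ℝ)..t, v r)) :=
      (continuousOn_primitive_of_integrableOn one_pos hvi t ht).tendsto.comp hsw
    have hdiff : Tendsto (fun m => (γ (s m) - γ 0) - ∫ r in (0 : ℝ)..s m, v r) atTop (𝓝 0) := by
      refine squeeze_zero_norm (fun m => ?_) (tendsto_iff_norm_sub_tendsto_zero.1 hv)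
      rw [← integral_gridVelocity γ (2 ^ m) ⌊(2 ^ m : ℕ) * t⌋₊]
      refine (norm_integral_sub_le (hmem m) hvL (hsI m)).trans_eq ?_
      rw [hvt]
    have := tendsto_nhds_unique (hγlim.sub hplim) hdiff
    rw [sub_eq_zero] at this
    rw [← this, add_sub_cancel]

end DyadicVelocity

section UnitInterval

variable {E : Type*} [NormedAddCommGroup E] {σ v : ℝ → E} {s t : ℝ}

theorem gridEnergy_le_gridEnergy {γ : ℝ → E}
    (h : ∀ s t, ‖γ t - γ s‖ ≤ ‖σ t - σ s‖) (N : ℕ) : gridEnergy γ N ≤ gridEnergy σ N := by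
  refine Finset.sum_le_sum fun i _ => ?_
  have := h (i / N) ((i + 1 : ℕ) / N)
  simp only [increment]
  gcongr

theorem intervalIntegrable_of_integrableOn_Ioo (hv : IntegrableOn v (Set.Ioo 0 1))
    (hs : s ∈ Set.Icc (0 : ℝ) 1) (ht : t ∈ Set.Icc (0 : ℝ) 1) : IntervalIntegrable v volume s t := by
  have h : IntegrableOn v (Set.Icc 0 1) :=
    (integrableOn_Icc_iff_integrableOn_Ioo (by simp) (by simp)).2 hv
  refine (h.mono_set ?_).intervalIntegrable
  exact Set.uIcc_subset_Icc hs ht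

variable [NormedSpace ℝ E]

theorem eq_add_integral_of_primitive (hv : IntegrableOn v (Set.Ioo 0 1))
    (h : ∀ t ∈ Set.Icc (0 : ℝ) 1, σ t = σ 0 + ∫ r in (0 : ℝ)..t, v r)
    (hs : s ∈ Set.Icc (0 : ℝ) 1) (ht : t ∈ Set.Icc (0 : ℝ) 1) :
    σ t = σ s + ∫ r in s..t, v r := by
  have h0 : (0 : ℝ) ∈ Set.Icc (0 : ℝ) 1 := ⟨le_rfl, zero_le_one⟩
  rw [h t ht, h s hs, add_assoc, intervalIntegral.integral_add_adjacent_intervals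
    (intervalIntegrable_of_integrableOn_Ioo hv h0 hs)
    (intervalIntegrable_of_integrableOn_Ioo hv hs ht)]

theorem norm_sub_sq_le (hv : MemLp v 2 (volume.restrict (Set.Ioo (0 : ℝ) 1)))
    (h : ∀ t ∈ Set.Icc (0 : ℝ) 1, σ t = σ 0 + ∫ r in (0 : ℝ)..t, v r)
    (hs : 0 ≤ s) (hst : s ≤ t) (ht : t ≤ 1) :
    ‖σ t - σ s‖ ^ 2 ≤ (t - s) * ∫ r in s..t, ‖v r‖ ^ 2 := by
  have hvi : IntegrableOn v (Set.Ioo (0 : ℝ) 1) := hv.integrable (by norm_num)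
  have hsub : Set.Ioo s t ⊆ Set.Ioo (0 : ℝ) 1 := Set.Ioo_subset_Ioo hs ht
  have hv' : MemLp v 2 (volume.restrict (Set.Ioo s t)) :=
    hv.mono_measure (Measure.restrict_mono hsub le_rfl)
  rw [eq_add_integral_of_primitive hvi h ⟨hs, hst.trans ht⟩ ⟨hs.trans hst, ht⟩, add_sub_cancel_left,
    intervalIntegral.integral_of_le hst, intervalIntegral.integral_of_le hst,
    integral_Ioc_eq_integral_Ioo, integral_Ioc_eq_integral_Ioo]
  have h1 := sq_integral_le hv'.norm
  rw [measureReal_restrict_apply MeasurableSet.univ, Set.univ_inter,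
    Real.volume_real_Ioo_of_le hst] at h1
  refine le_trans ?_ h1
  gcongr
  exact norm_integral_le_integral_norm _

theorem norm_sub_sq_le_mul (hv : MemLp v 2 (volume.restrict (Set.Ioo (0 : ℝ) 1)))
    (h : ∀ t ∈ Set.Icc (0 : ℝ) 1, σ t = σ 0 + ∫ r in (0 : ℝ)..t, v r) {A : ℝ}
    (hA : ∫ r in Set.Ioo (0 : ℝ) 1, ‖v r‖ ^ 2 ≤ A)
    (hs : s ∈ Set.Icc (0 : ℝ) 1) (ht : t ∈ Set.Icc (0 : ℝ) 1) :
    ‖σ t - σ s‖ ^ 2 ≤ A * |t - s| := by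
  wlog hst : s ≤ t generalizing s t
  · rw [norm_sub_rev, abs_sub_comm]
    exact this ht hs (le_of_not_ge hst)
  rw [abs_of_nonneg (sub_nonneg.2 hst), mul_comm A]
  refine (norm_sub_sq_le hv h hs.1 hst ht.2).trans
    (mul_le_mul_of_nonneg_left (le_trans ?_ hA) (sub_nonneg.2 hst))
  rw [intervalIntegral.integral_of_le hst, integral_Ioc_eq_integral_Ioo]
  exact setIntegral_mono_set hv.norm.integrable_sq (ae_of_all _ fun _ => sq_nonneg _)
    (Set.Ioo_subset_Ioo hs.1 ht.2).eventuallyLE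

theorem div_mem_Icc {N i : ℕ} (hi : i ≤ N) : (i : ℝ) / N ∈ Set.Icc (0 : ℝ) 1 :=
  ⟨by positivity, div_le_one_of_le₀ (by exact_mod_cast hi) (Nat.cast_nonneg N)⟩

/-- Cauchy–Schwarz on each interval of length `1/N`, summed over the grid. -/
theorem gridEnergy_le_integral (hv : MemLp v 2 (volume.restrict (Set.Ioo (0 : ℝ) 1)))
    (h : ∀ t ∈ Set.Icc (0 : ℝ) 1, σ t = σ 0 + ∫ r in (0 : ℝ)..t, v r) (N : ℕ) [NeZero N] :
    gridEnergy σ N ≤ ∫ r in Set.Ioo (0 : ℝ) 1, ‖v r‖ ^ 2 := by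
  have hN := cast_pos_of_neZero N
  have hi : IntegrableOn (fun r => ‖v r‖ ^ 2) (Set.Ioo (0 : ℝ) 1) := hv.norm.integrable_sq
  have hsum := intervalIntegral.sum_integral_adjacent_intervals (f := fun r => ‖v r‖ ^ 2)
    (μ := volume) (a := fun i : ℕ => (i : ℝ) / N) (n := N) fun i hi' =>
      intervalIntegrable_of_integrableOn_Ioo hi (div_mem_Icc hi'.le) (div_mem_Icc hi')
  rw [Nat.cast_zero, zero_div, div_self hN.ne', intervalIntegral.integral_of_le zero_le_one,
    integral_Ioc_eq_integral_Ioo] at hsum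
  rw [← hsum, gridEnergy]
  refine Finset.sum_le_sum fun i hi' => ?_
  have hi'' := Finset.mem_range.1 hi'
  have h1 := norm_sub_sq_le hv h (div_mem_Icc hi''.le).1
    (show (i : ℝ) / N ≤ (i + 1 : ℕ) / N by push_cast; gcongr; linarith) (div_mem_Icc hi'').2
  have h2 : ((i + 1 : ℕ) : ℝ) / N - i / N = (N : ℝ)⁻¹ := by
    push_cast
    field_simp
    ring
  rw [h2] at h1
  calc (N : ℝ) * ‖increment σ N i‖ ^ 2
      ≤ N * ((N : ℝ)⁻¹ * ∫ r in (i : ℝ) / N..(i + 1 : ℕ) / N, ‖v r‖ ^ 2) := by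
        gcongr
        exact h1
    _ = _ := by field_simp

end UnitInterval

/-! ### Sorting curves into `Mon` and passing to limits. -/

section Sorting

variable (n : ℕ) [NeZero n]

theorem exists_sorted (M : L2I) : ∃ x y, stepFun n x = stepProj n M ∧ OrbitRel x y ∧ IsMonVec y := by
  obtain ⟨x, hx⟩ := exists_stepProj_eq n M
  obtain ⟨y, hxy, hy⟩ := exists_isMonVec_orbitRel x
  exact ⟨x, y, hx, hxy, hy⟩

/-- The rearrangement in `Mon` of the projection to the step functions with `n` steps. -/
def sortStep (M : L2I) : L2I := stepFun n (exists_sorted n M).choose_spec.choose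

theorem sortStep_spec (M : L2I) :
    ∃ x y, stepFun n x = stepProj n M ∧ OrbitRel x y ∧ IsMonVec y ∧ sortStep n M = stepFun n y :=
  ⟨_, _, (exists_sorted n M).choose_spec.choose_spec.1,
    (exists_sorted n M).choose_spec.choose_spec.2.1,
    (exists_sorted n M).choose_spec.choose_spec.2.2, rfl⟩

theorem isMon_sortStep (M : L2I) : IsMon (sortStep n M) := by
  obtain ⟨x, y, hx, hxy, hy, h⟩ := sortStep_spec n M
  exact h ▸ hy.isMon_stepFun

/-- Projection and sorting are both contractions. This bound needs no derivative of the sorted curve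
and controls its increments at all pairs of times. -/
theorem norm_sortStep_sub_le (M N : L2I) : ‖sortStep n M - sortStep n N‖ ≤ ‖M - N‖ := by
  obtain ⟨x, y, hx, hxy, hy, h⟩ := sortStep_spec n M
  obtain ⟨x', y', hx', hxy', hy', h'⟩ := sortStep_spec n N
  rw [h, h']
  refine (norm_stepFun_sub_le n (hy.sum_sq_le hy' hxy hxy')).trans ?_
  rw [hx, hx', ← map_sub]
  exact norm_stepProj_le n _

theorem mean_sortStep (M : L2I) : mean (sortStep n M) = mean M := by
  obtain ⟨x, y, hx, hxy, hy, h⟩ := sortStep_spec n M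
  rw [h, mean_stepFun, hxy.sum_eq, ← mean_stepFun, hx, mean_stepProj]

theorem IsInvariantContinuous.apply_sortStep {U : L2I → ℝ} (hU : IsInvariantContinuous U) (M : L2I) :
    U (sortStep n M) = U (stepProj n M) := by
  obtain ⟨x, y, hx, hxy, hy, h⟩ := sortStep_spec n M
  rw [h, hU.stepFun_eq hxy, hx]

theorem IsPotentialPair.potential_sortStep {V : ℝ → ℝ → ℝ} {W : ℝ → ℝ} (h : IsPotentialPair V W)
    (t : ℝ) (M : L2I) : potential V W t (sortStep n M) = potential V W t (stepProj n M) := by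
  obtain ⟨x, y, hx, hxy, hy, e⟩ := sortStep_spec n M
  rw [e, h.potential_stepFun t hxy, hx]

/-- An ordered step function `z` close to `M` is its own sorting, so by contraction sorting brings
the projection of `M` no further from `z`. The distance from `z` to `M` is paid twice. -/
theorem IsMon.tendsto_sortStep {M : L2I} (hM : IsMon M) :
    Tendsto (fun k : ℕ => sortStep (k + 1) M) atTop (𝓝 M) := by
  have key : ∀ k : ℕ, ‖sortStep (k + 1) M - M‖ ≤
      ‖stepProj (k + 1) M - M‖ + 2 * √(1 / ((k : ℝ) + 1)) := by
    intro k
    obtain ⟨z, hz, hMz⟩ := hM.exists_stepFun (k + 1)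
    obtain ⟨x, y, hx, hxy, hy, h⟩ := sortStep_spec (k + 1) M
    have h1 : ‖M - stepFun (k + 1) z‖ ≤ √(1 / ((k : ℝ) + 1)) := by
      refine Real.le_sqrt_of_sq_le (hMz.trans_eq ?_)
      push_cast
      rw [one_div]
    have h2 := norm_stepFun_sub_le (k + 1) (hy.sum_sq_le hz hxy (OrbitRel.refl z))
    rw [hx, ← h] at h2
    have h3 := norm_sub_le_norm_sub_add_norm_sub (sortStep (k + 1) M) (stepFun (k + 1) z) M
    have h4 := norm_sub_le_norm_sub_add_norm_sub (stepProj (k + 1) M) M (stepFun (k + 1) z)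
    rw [norm_sub_rev (stepFun (k + 1) z) M] at h3
    linarith
  refine tendsto_iff_norm_sub_tendsto_zero.2 (squeeze_zero (fun _ => norm_nonneg _) key ?_)
  have h1 := tendsto_iff_norm_sub_tendsto_zero.1 (tendsto_stepProj M)
  have h2 := (Real.continuous_sqrt.tendsto 0).comp (tendsto_one_div_add_atTop_nhds_zero_nat (𝕜 := ℝ))
  simpa using h1.add (h2.const_mul 2)

end Sorting

/-- Each curve that starts in `Mon` can be replaced by a curve in `Mon` whose increments are not
larger and whose mean, potential energy, initial value and final cost are almost the same. -/
theorem exists_isMon_curve {V : ℝ → ℝ → ℝ} {W : ℝ → ℝ} (hVW : IsPotentialPair V W) {U : L2I → ℝ}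
    (hU : IsInvariantContinuous U) {σ : ℝ → L2I} (hσ : ContinuousOn σ (Set.Icc 0 1))
    (hM : IsMon (σ 0)) {ε : ℝ} (hε : 0 < ε) :
    ∃ γ : ℝ → L2I, (∀ t, IsMon (γ t)) ∧ (∀ s t, ‖γ t - γ s‖ ≤ ‖σ t - σ s‖) ∧
      (∀ t, mean (γ t) = mean (σ t)) ∧ ‖γ 0 - σ 0‖ < ε ∧
      |(∫ t in Set.Ioo (0 : ℝ) 1, potential V W t (γ t)) -
        ∫ t in Set.Ioo (0 : ℝ) 1, potential V W t (σ t)| < ε ∧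
      |U (γ 1) - U (σ 1)| < ε := by
  obtain ⟨B, hB0, hB⟩ := hVW.exists_potential_bound
  obtain ⟨K, hK0, hK⟩ := hVW.exists_potential_lipschitz
  -- Only at time 0 must the sorted value approach the curve itself, which is where `Mon` enters.
  -- For `U` and the potential energy convergence of the projections suffices, since sorting does
  -- not change them.
  have h1 : ∀ᶠ k : ℕ in atTop, ‖sortStep (k + 1) (σ 0) - σ 0‖ < ε :=
    (tendsto_iff_norm_sub_tendsto_zero.1 hM.tendsto_sortStep).eventually (gt_mem_nhds hε)
  have h2 : ∀ᶠ k : ℕ in atTop, |U (stepProj (k + 1) (σ 1)) - U (σ 1)| < ε :=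
    (tendsto_iff_norm_sub_tendsto_zero.1 ((hU.continuous.tendsto _).comp
      (tendsto_stepProj (σ 1)))).eventually (gt_mem_nhds hε)
  have h3 : Tendsto (fun k : ℕ => ∫ t in Set.Ioo (0 : ℝ) 1, potential V W t (stepProj (k + 1) (σ t)))
      atTop (𝓝 (∫ t in Set.Ioo (0 : ℝ) 1, potential V W t (σ t))) := by
    refine tendsto_integral_of_dominated_convergence (fun _ => B) (fun k => ?_)
      (integrable_const _) (fun k => ae_of_all _ fun t => hB _ _) (ae_of_all _ fun t => ?_)
    · exact (hVW.integrableOn_potential ((stepProj (k + 1)).continuous.comp_continuousOn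
        (hσ.mono Set.Ioo_subset_Icc_self))).aestronglyMeasurable
    · have := (tendsto_iff_norm_sub_tendsto_zero.1 (tendsto_stepProj (σ t))).const_mul K
      rw [mul_zero] at this
      refine tendsto_iff_norm_sub_tendsto_zero.2 (squeeze_zero (fun _ => norm_nonneg _)
        (fun k => ?_) this)
      simpa using hK t t (stepProj (k + 1) (σ t)) (σ t)
  obtain ⟨k, hk1, hk2, hk3⟩ := (h1.and (h2.and
    ((tendsto_iff_norm_sub_tendsto_zero.1 h3).eventually (gt_mem_nhds hε)))).exists
  refine ⟨fun t => sortStep (k + 1) (σ t), fun t => isMon_sortStep _ _,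
    fun s t => norm_sortStep_sub_le _ _ _, fun t => mean_sortStep _ _, hk1, ?_, ?_⟩
  · simp_rw [hVW.potential_sortStep (k + 1)]
    exact hk3
  · rw [hU.apply_sortStep (k + 1)]
    exact hk2

/-- Compactness and lower semicontinuity of the kinetic energy along curves in `Mon`. -/
theorem exists_subseq_limit_curve {σ v γ : ℕ → ℝ → L2I} {A C : ℝ}
    (hv : ∀ k, MemLp (v k) 2 (volume.restrict (Set.Ioo (0 : ℝ) 1)))
    (hσ : ∀ k, ∀ t ∈ Set.Icc (0 : ℝ) 1, σ k t = σ k 0 + ∫ r in (0 : ℝ)..t, v k r)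
    (hA : ∀ k, ∫ r in Set.Ioo (0 : ℝ) 1, ‖v k r‖ ^ 2 ≤ A)
    (hγ : ∀ k t, IsMon (γ k t)) (hγσ : ∀ k s t, ‖γ k t - γ k s‖ ≤ ‖σ k t - σ k s‖)
    (hC : ∀ k, ‖γ k 0‖ ≤ C) :
    ∃ (φ : ℕ → ℕ) (τ w : ℝ → L2I) (e : ℝ), StrictMono φ ∧
      (∀ t ∈ Set.Icc (0 : ℝ) 1, Tendsto (fun k => γ (φ k) t) atTop (𝓝 (τ t))) ∧
      Tendsto (fun k => ∫ r in Set.Ioo (0 : ℝ) 1, ‖v (φ k) r‖ ^ 2) atTop (𝓝 e) ∧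
      MemLp w 2 (volume.restrict (Set.Ioo (0 : ℝ) 1)) ∧
      ∫ r in Set.Ioo (0 : ℝ) 1, ‖w r‖ ^ 2 ≤ e ∧
      ∀ t ∈ Set.Icc (0 : ℝ) 1, τ t = τ 0 + ∫ r in (0 : ℝ)..t, w r := by
  have hA0 : 0 ≤ A := (integral_nonneg fun _ => sq_nonneg _).trans (hA 0)
  -- A common Hölder modulus of exponent 1/2, inherited from the original curves through their
  -- energy bound.
  have hmod : ∀ k, ∀ s ∈ Set.Icc (0 : ℝ) 1, ∀ t ∈ Set.Icc (0 : ℝ) 1,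
      dist (γ k t) (γ k s) ≤ √(A * |t - s|) := fun k s hs t ht => by
    rw [dist_eq_norm]
    exact (hγσ k s t).trans (Real.le_sqrt_of_sq_le (norm_sub_sq_le_mul (hv k) (hσ k) (hA k) hs ht))
  have hlim0 : Tendsto (fun r : ℝ => √(A * r)) (𝓝 0) (𝓝 0) := by
    have : Continuous fun r : ℝ => √(A * r) := by fun_prop
    simpa using this.tendsto 0
  have hcont : ∀ k, Continuous fun t : Set.Icc (0 : ℝ) 1 => γ k t := fun k =>
    (Metric.equicontinuous_of_continuity_modulus (fun r => √(A * r)) hlim0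
      (fun (_ : Unit) (t : Set.Icc (0 : ℝ) 1) => γ k t) fun s t _ => by
        rw [Subtype.dist_eq, Real.dist_eq, dist_comm, abs_sub_comm]
        exact hmod k s s.2 t t.2).continuous ()
  let F : ℕ → BoundedContinuousFunction (Set.Icc (0 : ℝ) 1) L2I := fun k =>
    BoundedContinuousFunction.mkOfCompact ⟨fun t => γ k t, hcont k⟩
  have h0 : (0 : ℝ) ∈ Set.Icc (0 : ℝ) 1 := ⟨le_rfl, zero_le_one⟩
  have hcompact : IsCompact (closure (Set.range F)) := by
    refine BoundedContinuousFunction.arzela_ascoli _ (isCompact_isMon (C + √A)) _ ?_ ?_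
    · rintro _ t ⟨k, rfl⟩
      refine ⟨hγ k t, ?_⟩
      have h1 := hmod k 0 h0 t t.2
      have h2 : A * |(t : ℝ) - 0| ≤ A := mul_le_of_le_one_right hA0 (by
        rw [sub_zero, abs_of_nonneg t.2.1]; exact t.2.2)
      have h3 := norm_le_norm_add_norm_sub' (γ k t) (γ k 0)
      rw [dist_eq_norm] at h1
      exact h3.trans (add_le_add (hC k) (h1.trans (Real.sqrt_le_sqrt h2)))
    · refine Metric.equicontinuous_of_continuity_modulus (fun r => √(A * r)) hlim0 _ ?_
      rintro s t ⟨_, k, rfl⟩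
      rw [Subtype.dist_eq, Real.dist_eq, dist_comm, abs_sub_comm]
      exact hmod k s s.2 t t.2
  obtain ⟨f, -, φ, hφ, hf⟩ := hcompact.tendsto_subseq fun k => subset_closure (Set.mem_range_self k)
  -- A further subsequence along which the kinetic energies of the original curves converge.
  obtain ⟨e, -, ψ, hψ, he⟩ := (isCompact_Icc (a := 0) (b := A)).tendsto_subseq
    (x := fun k => ∫ r in Set.Ioo (0 : ℝ) 1, ‖v (φ k) r‖ ^ 2)
    fun k => ⟨integral_nonneg fun _ => sq_nonneg _, hA _⟩
  let τ : ℝ → L2I := fun t => f (Set.projIcc 0 1 zero_le_one t)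
  have hτ : ∀ t ∈ Set.Icc (0 : ℝ) 1, Tendsto (fun k => γ (φ (ψ k)) t) atTop (𝓝 (τ t)) := by
    intro t ht
    have h1 := ((BoundedContinuousFunction.lipschitz_eval_const
      (Set.projIcc 0 1 zero_le_one t)).continuous.tendsto f).comp (hf.comp hψ.tendsto_atTop)
    simpa [F, τ, Function.comp_def, Set.projIcc_of_mem _ ht] using h1
  have hτc : Continuous τ := f.continuous.comp continuous_projIcc
  -- On a fixed grid the energy involves finitely many values, so pointwise convergence suffices;
  -- this gives lower semicontinuity without weak limits of velocities.
  have hgrid : ∀ m : ℕ, gridEnergy τ (2 ^ m) ≤ e := by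
    intro m
    have h1 : Tendsto (fun k => gridEnergy (γ (φ (ψ k))) (2 ^ m)) atTop
        (𝓝 (gridEnergy τ (2 ^ m))) := by
      refine tendsto_finsetSum _ fun i hi => ?_
      have hi' := Finset.mem_range.1 hi
      exact (((hτ _ (div_mem_Icc hi')).sub (hτ _ (div_mem_Icc hi'.le))).norm.pow 2).const_mul _
    exact le_of_tendsto_of_tendsto' h1 he fun k =>
      (gridEnergy_le_gridEnergy (hγσ _) _).trans (gridEnergy_le_integral (hv _) (hσ _) _)
  obtain ⟨w, hw, hwe, hτw⟩ := exists_velocity_of_gridEnergy_le hτc.continuousOn hgrid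
  exact ⟨φ ∘ ψ, τ, w, e, hφ.comp hψ, hτ, he, hw, hwe, hτw⟩

/-- The real cost `∫_0^1 𝓛_c(t, σ_t, v_t) dt + U(σ_1)` of a curve with square integrable
velocity. -/
def cost (V : ℝ → ℝ → ℝ) (W : ℝ → ℝ) (c : ℝ) (U : L2I → ℝ) (σ v : ℝ → L2I) : ℝ :=
  (∫ t in Set.Ioo (0 : ℝ) 1, lagrangianC V W c t (σ t) (v t)) + U (σ 1)

/-! ### Existence of a minimizer in `Mon`. -/

section Minimizer

variable {V : ℝ → ℝ → ℝ} {W : ℝ → ℝ} {c : ℝ} {U : L2I → ℝ} {M : L2I}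

theorem IsPotentialPair.cost_eq (hVW : IsPotentialPair V W) (c : ℝ) (U : L2I → ℝ) {σ v : ℝ → L2I}
    (hv : MemLp v 2 (volume.restrict (Set.Ioo (0 : ℝ) 1)))
    (h : HasWeakDerivOn (Set.Icc 0 1) σ v) :
    cost V W c U σ v = (1 / 2) * (∫ t in Set.Ioo (0 : ℝ) 1, ‖v t‖ ^ 2) -
      (∫ t in Set.Ioo (0 : ℝ) 1, potential V W t (σ t)) - c * (mean (σ 1) - mean (σ 0)) +
        U (σ 1) := by
  rw [cost, hVW.integral_lagrangianC c one_pos h.continuousOn hv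
    (h.eq_add_integral one_pos 1 ⟨zero_le_one, le_rfl⟩)]

theorem IsPotentialPair.exists_kinetic_le_cost (hVW : IsPotentialPair V W) (c : ℝ)
    (hU : IsInvariantContinuous U) :
    ∃ B, ∀ σ v : ℝ → L2I, MemLp v 2 (volume.restrict (Set.Ioo (0 : ℝ) 1)) →
      HasWeakDerivOn (Set.Icc 0 1) σ v →
      (1 / 4) * (∫ t in Set.Ioo (0 : ℝ) 1, ‖v t‖ ^ 2) - B ≤ cost V W c U σ v := by
  obtain ⟨B, hB0, hB⟩ := hVW.exists_norm_sq_le c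
  obtain ⟨D, hD⟩ := hU.exists_bound
  refine ⟨B + D, fun σ v hv h => ?_⟩
  have h1 := hv.norm.integrable_sq.const_mul (1 / 4)
  have h2 : ∫ t in Set.Ioo (0 : ℝ) 1, ((1 / 4) * ‖v t‖ ^ 2 - B) ≤
      ∫ t in Set.Ioo (0 : ℝ) 1, lagrangianC V W c t (σ t) (v t) :=
    integral_mono (h1.sub (integrable_const B))
      (hVW.integrableOn_lagrangianC c (h.continuousOn.mono Set.Ioo_subset_Icc_self) hv)
      fun t => hB _ _ _
  rw [integral_sub h1 (integrable_const B), integral_const_mul, integral_const,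
    measureReal_restrict_apply MeasurableSet.univ, Set.univ_inter,
    Real.volume_real_Ioo_of_le zero_le_one, sub_zero, one_smul] at h2
  have := (abs_le.1 (hD (σ 1))).1
  rw [cost]
  linarith

theorem HasWeakDerivOn.const (M : L2I) : HasWeakDerivOn (Set.Icc 0 1) (fun _ => M) 0 :=
  HasWeakDerivOn.of_primitive one_pos (integrable_zero _ _ _) fun t _ => by simp

/-- The direct method, applied to the sorted versions of a minimizing sequence, with sorting errors
at most `1/(k+1)`. -/
theorem exists_isMon_minimizer (hVW : IsPotentialPair V W) (c : ℝ) (hU : IsInvariantContinuous U)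
    (hM : IsMon M) :
    ∃ τ w : ℝ → L2I, HasWeakDerivOn (Set.Icc 0 1) τ w ∧
      MemLp w 2 (volume.restrict (Set.Ioo (0 : ℝ) 1)) ∧ τ 0 = M ∧
      (∀ t ∈ Set.Icc (0 : ℝ) 1, IsMon (τ t)) ∧
      ∀ σ v : ℝ → L2I, HasWeakDerivOn (Set.Icc 0 1) σ v →
        MemLp v 2 (volume.restrict (Set.Ioo (0 : ℝ) 1)) → σ 0 = M →
        cost V W c U τ w ≤ cost V W c U σ v := by
  obtain ⟨B, hB⟩ := hVW.exists_kinetic_le_cost c hU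
  have h0 : (0 : ℝ) ∈ Set.Icc (0 : ℝ) 1 := ⟨le_rfl, zero_le_one⟩
  have h1 : (1 : ℝ) ∈ Set.Icc (0 : ℝ) 1 := ⟨zero_le_one, le_rfl⟩
  set R : Set ℝ := {x | ∃ σ v : ℝ → L2I, HasWeakDerivOn (Set.Icc 0 1) σ v ∧
    MemLp v 2 (volume.restrict (Set.Ioo (0 : ℝ) 1)) ∧ σ 0 = M ∧ cost V W c U σ v = x} with hR
  have hRne : R.Nonempty := ⟨_, fun _ => M, 0, HasWeakDerivOn.const M, MemLp.zero, rfl, rfl⟩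
  have hRb : BddBelow R := ⟨-B, by
    rintro _ ⟨σ, v, h, hv, -, rfl⟩
    have : 0 ≤ ∫ t in Set.Ioo (0 : ℝ) 1, ‖v t‖ ^ 2 := integral_nonneg fun _ => sq_nonneg _
    linarith [hB σ v hv h]⟩
  obtain ⟨u, -, hu, huR⟩ := exists_seq_tendsto_sInf hRne hRb
  choose σ v hσ hv hσ0 hcost using huR
  obtain ⟨D, hD⟩ := hu.bddAbove_range
  have hA : ∀ k, ∫ r in Set.Ioo (0 : ℝ) 1, ‖v k r‖ ^ 2 ≤ 4 * (D + B) := fun k => by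
    have h2 := hB _ _ (hv k) (hσ k)
    rw [hcost k] at h2
    linarith [hD (Set.mem_range_self k)]
  have hγex := fun k : ℕ => exists_isMon_curve hVW hU (hσ k).continuousOn ((hσ0 k).symm ▸ hM)
    (Nat.one_div_pos_of_nat (α := ℝ) (n := k))
  choose γ hγ hγσ hγm hγ0 hγp hγU using hγex
  have hsmall := tendsto_one_div_add_atTop_nhds_zero_nat (𝕜 := ℝ)
  have hC : ∀ k, ‖γ k 0‖ ≤ ‖M‖ + 1 := fun k => by
    have h2 := hγ0 k
    rw [hσ0 k] at h2
    have h3 : 1 / ((k : ℝ) + 1) ≤ 1 := by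
      rw [div_le_one (by positivity)]
      linarith [Nat.cast_nonneg (α := ℝ) k]
    have h4 := norm_le_norm_add_norm_sub' (γ k 0) M
    linarith
  obtain ⟨φ, τ, w, e, hφ, hτ, he, hw, hwe, hτw⟩ := exists_subseq_limit_curve hv
    (fun k => (hσ k).eq_add_integral one_pos) hA hγ hγσ hC
  have hτd : HasWeakDerivOn (Set.Icc 0 1) τ w :=
    HasWeakDerivOn.of_primitive one_pos (hw.integrable (by norm_num)) hτw
  have hsmallφ := hsmall.comp hφ.tendsto_atTop
  have hτ0 : τ 0 = M := by
    refine tendsto_nhds_unique (hτ 0 h0) (tendsto_iff_norm_sub_tendsto_zero.2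
      (squeeze_zero (fun _ => norm_nonneg _) (fun k => ?_) hsmallφ))
    have h2 := hγ0 (φ k)
    rw [hσ0] at h2
    exact h2.le
  refine ⟨τ, w, hτd, hw, hτ0, fun t ht => isClosed_isMon.mem_of_tendsto (hτ t ht)
    (Eventually.of_forall fun k => hγ _ t), fun σ' v' hσ' hv' hσ'0 => ?_⟩
  refine le_trans ?_ (csInf_le hRb ⟨σ', v', hσ', hv', hσ'0, rfl⟩)
  -- The curves `σ (φ k)` need not converge; their potential energies do, because they differ by a
  -- vanishing error from those of the converging sorted curves. The final costs are treated alike,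
  -- and the means agree exactly.
  have hpot : Tendsto (fun k => ∫ t in Set.Ioo (0 : ℝ) 1, potential V W t (σ (φ k) t)) atTop
      (𝓝 (∫ t in Set.Ioo (0 : ℝ) 1, potential V W t (τ t))) := by
    obtain ⟨P, hP0, hP⟩ := hVW.exists_potential_bound
    obtain ⟨K, hK0, hK⟩ := hVW.exists_potential_lipschitz
    have h2 : Tendsto (fun k => ∫ t in Set.Ioo (0 : ℝ) 1, potential V W t (γ (φ k) t)) atTop
        (𝓝 (∫ t in Set.Ioo (0 : ℝ) 1, potential V W t (τ t))) := by
      refine tendsto_integral_of_dominated_convergence (fun _ => P) (fun k => ?_)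
        (integrable_const _) (fun k => ae_of_all _ fun t => hP _ _) ?_
      · refine (hVW.integrableOn_potential fun t ht => ?_).aestronglyMeasurable
        refine tendsto_iff_norm_sub_tendsto_zero.2 (squeeze_zero (fun _ => norm_nonneg _)
          (fun s => hγσ (φ k) t s) (tendsto_iff_norm_sub_tendsto_zero.1
            (((hσ (φ k)).continuousOn.mono Set.Ioo_subset_Icc_self) t ht)))
      · rw [ae_restrict_iff' measurableSet_Ioo]
        refine ae_of_all _ fun t ht => ?_
        have h3 := (tendsto_iff_norm_sub_tendsto_zero.1
          (hτ t (Set.Ioo_subset_Icc_self ht))).const_mul K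
        rw [mul_zero] at h3
        refine tendsto_iff_norm_sub_tendsto_zero.2 (squeeze_zero (fun _ => norm_nonneg _)
          (fun k => ?_) h3)
        simpa using hK t t (γ (φ k) t) (τ t)
    have h3 := squeeze_zero_norm (f := fun k =>
      (∫ t in Set.Ioo (0 : ℝ) 1, potential V W t (γ (φ k) t)) -
        ∫ t in Set.Ioo (0 : ℝ) 1, potential V W t (σ (φ k) t)) (fun k => (hγp (φ k)).le) hsmallφ
    simpa using h2.sub h3
  have hUlim : Tendsto (fun k => U (σ (φ k) 1)) atTop (𝓝 (U (τ 1))) := by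
    have h2 := (hU.continuous.tendsto _).comp (hτ 1 h1)
    have h3 := squeeze_zero_norm (f := fun k => U (γ (φ k) 1) - U (σ (φ k) 1))
      (fun k => (hγU (φ k)).le) hsmallφ
    simpa using h2.sub h3
  have hmean : ∀ t ∈ Set.Icc (0 : ℝ) 1,
      Tendsto (fun k => mean (σ (φ k) t)) atTop (𝓝 (mean (τ t))) := fun t ht => by
    simp_rw [← hγm]
    exact (mean.continuous.tendsto _).comp (hτ t ht)
  have hlim : Tendsto (fun k => u (φ k)) atTop (𝓝 ((1 / 2) * e -
      (∫ t in Set.Ioo (0 : ℝ) 1, potential V W t (τ t)) - c * (mean (τ 1) - mean (τ 0)) +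
        U (τ 1))) := by
    simp_rw [← hcost, hVW.cost_eq c U (hv _) (hσ _)]
    exact (((he.const_mul _).sub hpot).sub (((hmean 1 h1).sub (hmean 0 h0)).const_mul c)).add hUlim
  have heq := tendsto_nhds_unique hlim (hu.comp hφ.tendsto_atTop)
  -- The infimum is the cost expression of `τ` with `e` in place of its kinetic energy, and `hwe`
  -- says that `e` is at least that energy.
  rw [← heq, hVW.cost_eq c U hw hτd]
  linarith

/-! ### Splicing, `c`-minimality and the Lax–Oleinik infimum. -/

theorem IsIntegerValued.sub {Z Z' : L2I} (h : IsIntegerValued Z) (h' : IsIntegerValued Z') :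
    IsIntegerValued (Z - Z') := by
  filter_upwards [Lp.coeFn_sub Z Z', h, h'] with z h1 ⟨k, hk⟩ ⟨l, hl⟩
  exact ⟨k - l, by rw [h1, Pi.sub_apply, hk, hl]; push_cast; rfl⟩

theorem isIntegerValued_zero : IsIntegerValued 0 := by
  filter_upwards [Lp.coeFn_zero ℝ 2 (volume : Measure ParamI)] with z hz
  exact ⟨0, by rw [hz]; simp⟩

theorem IsPotentialPair.lagrangianC_add (hVW : IsPotentialPair V W) (c t : ℝ) (M N : L2I) {Z : L2I}
    (hZ : IsIntegerValued Z) : lagrangianC V W c t (M + Z) N = lagrangianC V W c t M N := by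
  rw [lagrangianC_eq, lagrangianC_eq, hVW.potential_add t M hZ]

theorem action_congr_ae {a b : ℝ} {σ v v' : ℝ → L2I}
    (h : v =ᵐ[volume.restrict (Set.Ioo a b)] v') :
    action V W c a b σ v = action V W c a b σ v' := by
  have e : (fun t => lagrangianC V W c t (σ t) (v t)) =ᵐ[volume.restrict (Set.Ioo a b)]
      fun t => lagrangianC V W c t (σ t) (v' t) := h.mono fun t ht => by simp only [ht]
  exact congrArg₂ (fun x y : ENNReal => (x : EReal) - (y : EReal))
    (lintegral_congr_ae (e.fun_comp ENNReal.ofReal))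
    (lintegral_congr_ae (e.fun_comp fun x => ENNReal.ofReal (-x)))

/-- Replacing a curve on `[t₀,t₁]` by a curve with the same boundary values up to integer-valued
functions, and translating the pieces to obtain a continuous curve. -/
theorem exists_spliced_curve {τ w σ' v' : ℝ → L2I} {t₀ t₁ : ℝ}
    (hτ : HasWeakDerivOn (Set.Icc 0 1) τ w)
    (hw : MemLp w 2 (volume.restrict (Set.Ioo (0 : ℝ) 1)))
    (h01 : t₀ < t₁) (h0 : 0 ≤ t₀) (h1 : t₁ ≤ 1)
    (hv' : MemLp v' 2 (volume.restrict (Set.Ioo t₀ t₁)))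
    (hσ' : ∀ t ∈ Set.Icc t₀ t₁, σ' t = σ' t₀ + ∫ s in t₀..t, v' s)
    (hZ0 : IsIntegerValued (σ' t₀ - τ t₀)) (hZ1 : IsIntegerValued (σ' t₁ - τ t₁)) :
    ∃ ρ u : ℝ → L2I, HasWeakDerivOn (Set.Icc 0 1) ρ u ∧
      MemLp u 2 (volume.restrict (Set.Ioo (0 : ℝ) 1)) ∧ ρ 0 = τ 0 ∧
      (∃ Z, IsIntegerValued Z ∧ ρ 1 = τ 1 + Z) ∧
      (∀ t ∈ Set.Ioo t₀ t₁, u t = v' t ∧ ∃ Z, IsIntegerValued Z ∧ ρ t = σ' t + Z) ∧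
      ∀ t ∈ Set.Icc (0 : ℝ) 1, t ∉ Set.Ioo t₀ t₁ →
        u t = w t ∧ ∃ Z, IsIntegerValued Z ∧ ρ t = τ t + Z := by
  classical
  let u : ℝ → L2I := (Set.Ioo t₀ t₁).piecewise v' w
  have hu : MemLp u 2 (volume.restrict (Set.Ioo (0 : ℝ) 1)) := by
    refine MemLp.piecewise measurableSet_Ioo ?_ (hw.restrict _)
    exact hv'.mono_measure (Measure.restrict_mono_measure Measure.restrict_le_self _)
  have hui : IntegrableOn u (Set.Ioo 0 1) := hu.integrable (by norm_num)
  have hwi : IntegrableOn w (Set.Ioo 0 1) := hw.integrable (by norm_num)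
  have hmem0 : (0 : ℝ) ∈ Set.Icc (0 : ℝ) 1 := ⟨le_rfl, zero_le_one⟩
  have ht0 : t₀ ∈ Set.Icc (0 : ℝ) 1 := ⟨h0, h01.le.trans h1⟩
  have ht1 : t₁ ∈ Set.Icc (0 : ℝ) 1 := ⟨h0.trans h01.le, h1⟩
  let ρ : ℝ → L2I := fun t => τ 0 + ∫ s in (0 : ℝ)..t, u s
  have hρ0 : ρ 0 = τ 0 := by simp [ρ]
  have hρ : ∀ t ∈ Set.Icc (0 : ℝ) 1, ρ t = ρ 0 + ∫ s in (0 : ℝ)..t, u s := fun t _ => by rw [hρ0]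
  have hρstep : ∀ {s t : ℝ}, s ∈ Set.Icc (0 : ℝ) 1 → t ∈ Set.Icc (0 : ℝ) 1 →
      ρ t = ρ s + ∫ r in s..t, u r := fun hs ht => eq_add_integral_of_primitive hui hρ hs ht
  have hτp := hτ.eq_add_integral one_pos
  have hτstep : ∀ {s t : ℝ}, s ∈ Set.Icc (0 : ℝ) 1 → t ∈ Set.Icc (0 : ℝ) 1 →
      τ t = τ s + ∫ r in s..t, w r := fun hs ht => eq_add_integral_of_primitive hwi hτp hs ht
  have hleft : ∀ t, 0 ≤ t → t ≤ t₀ → ρ t = τ t := by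
    intro t ht htt
    have htI : t ∈ Set.Icc (0 : ℝ) 1 := ⟨ht, htt.trans ht0.2⟩
    rw [hρ t htI, hτp t htI, hρ0]
    congr 1
    refine intervalIntegral.integral_congr fun s hs => ?_
    rw [Set.uIcc_of_le ht] at hs
    exact Set.piecewise_eq_of_notMem _ _ _ fun h => absurd (hs.2.trans htt) (not_le.2 h.1)
  -- Integrating the spliced velocity translates the inserted piece so as to meet `τ` at `t₀`; the
  -- remainder of `τ` is then shifted by the difference of the two integer-valued discrepancies.
  have hmid : ∀ t ∈ Set.Icc t₀ t₁, ρ t = σ' t - (σ' t₀ - τ t₀) := by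
    intro t ht
    rw [hρstep ht0 ⟨h0.trans ht.1, ht.2.trans h1⟩, hleft t₀ h0 le_rfl, hσ' t ht]
    have : ∫ r in t₀..t, u r = ∫ r in t₀..t, v' r := by
      rw [intervalIntegral.integral_of_le ht.1, intervalIntegral.integral_of_le ht.1,
        integral_Ioc_eq_integral_Ioo, integral_Ioc_eq_integral_Ioo]
      exact setIntegral_congr_fun measurableSet_Ioo fun s hs =>
        Set.piecewise_eq_of_mem _ _ _ ⟨hs.1, hs.2.trans_le ht.2⟩
    rw [this]
    abel
  have hright : ∀ t, t₁ ≤ t → t ≤ 1 → ρ t = τ t + ((σ' t₁ - τ t₁) - (σ' t₀ - τ t₀)) := by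
    intro t htt ht
    have htI : t ∈ Set.Icc (0 : ℝ) 1 := ⟨ht1.1.trans htt, ht⟩
    rw [hρstep ht1 htI, hτstep ht1 htI, hmid t₁ ⟨h01.le, le_rfl⟩]
    have : ∫ r in t₁..t, u r = ∫ r in t₁..t, w r := by
      refine intervalIntegral.integral_congr fun s hs => ?_
      rw [Set.uIcc_of_le htt] at hs
      exact Set.piecewise_eq_of_notMem _ _ _ fun h => absurd hs.1 (not_le.2 h.2)
    rw [this]
    abel
  refine ⟨ρ, u, HasWeakDerivOn.of_primitive one_pos hui hρ, hu, hρ0,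
    ⟨_, hZ1.sub hZ0, hright 1 h1 le_rfl⟩, fun t ht => ?_, fun t ht htn => ?_⟩
  · refine ⟨Set.piecewise_eq_of_mem _ _ _ ht, _, isIntegerValued_zero.sub hZ0, ?_⟩
    rw [hmid t (Set.Ioo_subset_Icc_self ht), zero_sub, sub_eq_add_neg]
  · refine ⟨Set.piecewise_eq_of_notMem _ _ _ htn, ?_⟩
    rcases le_or_gt t t₀ with htt | htt
    · exact ⟨0, isIntegerValued_zero, by rw [hleft t ht.1 htt, add_zero]⟩
    · exact ⟨_, hZ1.sub hZ0, hright t (not_lt.1 fun h => htn ⟨htt, h⟩) ht.2⟩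

/-- The spliced curve starts at `τ 0` and ends at `τ 1` up to an integer-valued function, so `U`
takes the same value. The costs then differ exactly by the difference of the actions over `(t₀,t₁)`.
-/
theorem isCMinimal_of_cost_le (hVW : IsPotentialPair V W) (hU : IsInvariantContinuous U)
    {τ w : ℝ → L2I} (hτ : HasWeakDerivOn (Set.Icc 0 1) τ w)
    (hw : MemLp w 2 (volume.restrict (Set.Ioo (0 : ℝ) 1)))
    (hmin : ∀ σ v : ℝ → L2I, HasWeakDerivOn (Set.Icc 0 1) σ v →
      MemLp v 2 (volume.restrict (Set.Ioo (0 : ℝ) 1)) → σ 0 = τ 0 →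
      cost V W c U τ w ≤ cost V W c U σ v) :
    IsCMinimal V W c (Set.Icc 0 1) τ := by
  refine ⟨⟨w, hτ⟩, fun t₀ t₁ h01 hsub v hv σ' v' hσ' hσ'c hZ0 hZ1 => ?_⟩
  have h0 : 0 ≤ t₀ := (hsub ⟨le_rfl, h01.le⟩).1
  have h1 : t₁ ≤ 1 := (hsub ⟨h01.le, le_rfl⟩).2
  have hIoo : Set.Ioo t₀ t₁ ⊆ Set.Ioo (0 : ℝ) 1 := Set.Ioo_subset_Ioo h0 h1
  have hw' : MemLp w 2 (volume.restrict (Set.Ioo t₀ t₁)) :=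
    hw.mono_measure (Measure.restrict_mono hIoo le_rfl)
  have hτ' : HasWeakDerivOn (Set.Icc t₀ t₁) τ w :=
    HasWeakDerivOn.of_primitive h01 (hw'.integrable (by norm_num)) fun t ht =>
      eq_add_integral_of_primitive (hw.integrable (by norm_num)) (hτ.eq_add_integral one_pos)
        (hsub ⟨le_rfl, h01.le⟩) (hsub ht)
  -- The derivative in the definition of minimality is arbitrary; it agrees with `w` almost
  -- everywhere on `(t₀,t₁)`.
  rw [action_congr_ae (hv.ae_eq hτ')]
  by_cases htop : action V W c t₀ t₁ σ' v' = ⊤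
  · rw [htop]
    exact le_top
  have hσ'o := hσ'c.mono Set.Ioo_subset_Icc_self
  have hv' := hVW.memLp_of_action_ne_top hσ'o hσ'.locallyIntegrableOn htop
  obtain ⟨ρ, u, hρ, hu, hρ0, ⟨Z, hZ, hρ1⟩, hin, hout⟩ := exists_spliced_curve hτ hw h01 h0 h1 hv'
    (hσ'.eq_add_integral_of_Ioo h01 hσ'c (hv'.integrable (by norm_num))) hZ0 hZ1
  have hcost := hmin ρ u hρ hu hρ0
  rw [cost, cost, hρ1, hU.translation _ _ hZ] at hcost
  have hτo := hτ.continuousOn.mono (Set.Ioo_subset_Icc_self (a := (0 : ℝ)) (b := 1))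
  have hi1 := hVW.integrableOn_lagrangianC c hτo hw
  have hi2 := hVW.integrableOn_lagrangianC c (hτo.mono hIoo) hw'
  have hi3 := hVW.integrableOn_lagrangianC c hσ'o hv'
  have hsplit : ∀ t ∈ Set.Ioo (0 : ℝ) 1, lagrangianC V W c t (ρ t) (u t) =
      lagrangianC V W c t (τ t) (w t) + (Set.Ioo t₀ t₁).indicator (fun t =>
        lagrangianC V W c t (σ' t) (v' t) - lagrangianC V W c t (τ t) (w t)) t := by
    intro t ht
    by_cases htt : t ∈ Set.Ioo t₀ t₁
    · obtain ⟨hut, Z, hZ, hρt⟩ := hin t htt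
      rw [Set.indicator_of_mem htt, hut, hρt, hVW.lagrangianC_add c t _ _ hZ]
      ring
    · obtain ⟨hut, Z, hZ, hρt⟩ := hout t (Set.Ioo_subset_Icc_self ht) htt
      rw [Set.indicator_of_notMem htt, hut, hρt, hVW.lagrangianC_add c t _ _ hZ, add_zero]
  have hi4 : IntegrableOn ((Set.Ioo t₀ t₁).indicator (fun t =>
      lagrangianC V W c t (σ' t) (v' t) - lagrangianC V W c t (τ t) (w t))) (Set.Ioo 0 1) :=
    ((integrable_indicator_iff measurableSet_Ioo).2 (hi3.sub hi2)).integrableOn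
  rw [setIntegral_congr_fun measurableSet_Ioo hsplit, integral_add hi1 hi4,
    setIntegral_indicator measurableSet_Ioo, Set.inter_eq_right.2 hIoo, integral_sub hi3 hi2]
    at hcost
  rw [hVW.action_eq_coe c (hτo.mono hIoo) hw', hVW.action_eq_coe c hσ'o hv', EReal.coe_le_coe_iff]
  linarith

/-- Carries minimality among square integrable velocities over to all absolutely continuous curves,
the others having infinite action. -/
theorem laxOleinik_eq_of_cost_le (hVW : IsPotentialPair V W) {τ w : ℝ → L2I}
    (hτ : HasWeakDerivOn (Set.Icc 0 1) τ w)
    (hw : MemLp w 2 (volume.restrict (Set.Ioo (0 : ℝ) 1)))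
    (hmin : ∀ σ v : ℝ → L2I, HasWeakDerivOn (Set.Icc 0 1) σ v →
      MemLp v 2 (volume.restrict (Set.Ioo (0 : ℝ) 1)) → σ 0 = τ 0 →
      cost V W c U τ w ≤ cost V W c U σ v) :
    laxOleinik V W c U (τ 0) = (cost V W c U τ w : EReal) ∧
      action V W c 0 1 τ w + (U (τ 1) : EReal) = (cost V W c U τ w : EReal) := by
  have hact : ∀ σ v : ℝ → L2I, HasWeakDerivOn (Set.Icc 0 1) σ v →
      MemLp v 2 (volume.restrict (Set.Ioo (0 : ℝ) 1)) →
      action V W c 0 1 σ v + (U (σ 1) : EReal) = (cost V W c U σ v : EReal) := fun σ v hσ hv => by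
    rw [hVW.action_eq_coe c (hσ.continuousOn.mono Set.Ioo_subset_Icc_self) hv, ← EReal.coe_add, cost]
  refine ⟨le_antisymm (sInf_le ⟨τ, w, hτ, rfl, (hact τ w hτ hw).symm⟩) (le_sInf ?_), hact τ w hτ hw⟩
  rintro _ ⟨σ, v, hσ, hσ0, rfl⟩
  by_cases htop : action V W c 0 1 σ v = ⊤
  · rw [htop, EReal.top_add_coe]
    exact le_top
  have hv := hVW.memLp_of_action_ne_top (hσ.continuousOn.mono Set.Ioo_subset_Icc_self)
    (hσ.locallyIntegrableOn.mono_set Set.Ioo_subset_Icc_self) htop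
  rw [hact σ v hσ hv, EReal.coe_le_coe_iff]
  exact hmin σ v hσ hv hσ0

end Minimizer

end Vlasov

end

theorem proposition2p2 (V : ℝ → ℝ → ℝ) (W : ℝ → ℝ) (hVW : Vlasov.IsPotentialPair V W)
    (c : ℝ) (U : Vlasov.L2I → ℝ) (hU : Vlasov.IsInvariantContinuous U)
    (M : Vlasov.L2I) (hM : Vlasov.IsMon M) :
    (∃ r : ℝ, Vlasov.laxOleinik V W c U M = (r : EReal)) ∧
    ∃ σ v : ℝ → Vlasov.L2I,
      Vlasov.HasWeakDerivOn (Set.Icc 0 1) σ v ∧ σ 0 = M ∧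
      Vlasov.laxOleinik V W c U M =
        Vlasov.action V W c 0 1 σ v + (U (σ 1) : EReal) ∧
      Vlasov.IsCMinimal V W c (Set.Icc 0 1) σ ∧
      ∀ t ∈ Set.Icc (0 : ℝ) 1, Vlasov.IsMon (σ t) := by
  obtain ⟨τ, w, hτ, hw, rfl, hmon, hmin⟩ := Vlasov.exists_isMon_minimizer hVW c hU hM
  obtain ⟨h1, h2⟩ := Vlasov.laxOleinik_eq_of_cost_le hVW hτ hw hmin
  exact ⟨⟨_, h1⟩, τ, w, hτ, rfl, h1.trans h2.symm, Vlasov.isCMinimal_of_cost_le hVW hU hτ hw hmin,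
    hmon⟩
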